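/- **Setting.** Let $d\ge 1$ and let $\mathbf X$ be a spatial point process on $\mathbb R^d$ (a locally finite random subset of $\mathbb R^d$), observed in windows $D_n=nE=\{ne: e\in E\}$, $n\ge 1$, where $E\subset\mathbb R^d$ is convex, compact and contains the origin in its interior; $|D_n|$ is the Lebesgue measure of $D_n$. Let $z_1,z_2,\dots:\mathbb R^d\to\mathbb R$ be measurable covariates, $(p_n)$ a sequence of dimensions, $\mathbf z(u)=(z_1(u),\dots,z_{p_n}(u))^\top$, $\rho(u;\boldsymbol\beta)=\exp(\mathbf z(u)^\top\boldsymbol\beta)$ for $\boldsymbol\beta\in\mathbb R^{p_n}$, and let $w:\mathbb R^d\to[0,\infty)$ be a measurable weight function. The true parameter is $\boldsymbol\beta_0=(\beta_{01},\dots,\beta_{0s},0,\dots,0)^\top\in\mathbb R^{p_n}$, where $s\le p_n$ and the non-zero coefficients $\beta_{01},\dots,\beta_{0s}$ do not depend on $n$. For a penalty family $(p_\lambda)_{\lambda\ge0}$ and tuning parameters $\lambda_{n,j}\ge 0$ put $$Q_n(w;\boldsymbol\beta)=\sum_{u\in\mathbf X\cap D_n}w(u)\log\rho(u;\boldsymbol\beta)-\int_{D_n}w(u)\rho(u;\boldsymbol\beta)\,\mathrm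 du-|D_n|\sum_{j=1}^{p_n}p_{\lambda_{n,j}}(|\beta_j|),$$ $$a_n=\max_{j\le s}|p'_{\lambda_{n,j}}(|\beta_{0j}|)|,\qquad c_n=\max_{j\le s}|p''_{\lambda_{n,j}}(|\beta_{0j}|)|,\qquad \mathbf A_n=\int_{D_n}w(u)\mathbf z(u)\mathbf z(u)^\top\rho(u;\boldsymbol\beta_0)\,\mathrm du .$$ For $k,l\in\mathbb N\cup\{\infty\}$ the mixing coefficient $\alpha_{k,l}(q)$ is the supremum of $|\mathrm P(A\cap B)-\mathrm P(A)\mathrm P(B)|$ over $A\in\mathscr F(\Lambda_1)$, $B\in\mathscr F(\Lambda_2)$ and Borel sets $\Lambda_1,\Lambda_2$ with $|\Lambda_1|\le k$, $|\Lambda_2|\le l$ and distance at least $q$, where $\mathscr F(\Lambda)$ is the $\sigma$-algebra generated by $\mathbf X\cap\Lambda$. **Conditions.** 1. $\mathbf X$ has intensity function $\rho(\cdot;\boldsymbol\beta_0)$; $\boldsymbol\beta_0\in\Theta_n$ with $\Theta_n\subset\mathbb R^{p_n}$ open, convex and bounded; and there are neighbourhoods $\Xi_n\subset\mathbb R^{p_n}$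 of $\boldsymbol\beta_0$ with $\sup_n\sup_{\boldsymbol\beta\in\Xi_n}\sup_{u}\rho(u;\boldsymbol\beta)<\infty$. 2. $\sup_n\sup_{i\le p_n}\sup_u|z_i(u)|<\infty$ and $\sup_u w(u)<\infty$. 3. There is an integer $t\ge1$ such that for $k=2,\dots,2+t$ the product density $\rho^{(k)}$ of $\mathbf X$ exists and is bounded. 4. $\alpha_{2,\infty}(q)=O(q^{-\tilde t})$ as $q\to\infty$ for some $\tilde t>d(2+t)/t$. 5. $\liminf_n\nu_{\min}(|D_n|^{-1}\mathbf A_n)>0$, where $\nu_{\min}$ is the smallest eigenvalue. 6. For every $\lambda\ge0$, $p_\lambda$ is non-negative on $[0,\infty)$, $p_\lambda(0)=0$, and $p_\lambda$ is continuously differentiable on $(0,\infty)$ with Lipschitz derivative there. Moreover, for $j\le s$ there are $(\tilde r_{n,j})_n$ with $\tilde r_{n,j}\sqrt{|D_n|/p_n}\to\infty$ such that for all large $n$, $p_{\lambda_{n,j}}$ is three times continuously differentiable on the ball with centre $|\beta_{0j}|$ and radius $\tilde r_{n,j}$, with third derivative bounded there uniformly in $n$ and $j$. 7. $p_n^3/|D_n|\to0$.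 **Theorem.** Assume these conditions, $a_n=O(|D_n|^{-1/2})$ and $c_n=o(1)$. Then there are random vectors $\hat{\boldsymbol\beta}=\hat{\boldsymbol\beta}_n\in\mathbb R^{p_n}$ such that, with probability tending to $1$, $\hat{\boldsymbol\beta}$ is a local maximizer of $Q_n(w;\cdot)$, and $$\|\hat{\boldsymbol\beta}-\boldsymbol\beta_0\|=O_{\mathrm P}\big(\sqrt{p_n}\,(|D_n|^{-1/2}+a_n)\big).$$ In particular $\|\hat{\boldsymbol\beta}-\boldsymbol\beta_0\|=O_{\mathrm P}(\sqrt{p_n/|D_n|})$, i.e. $\hat{\boldsymbol\beta}$ is root-$(|D_n|/p_n)$ consistent. If moreover, for every $K>0$, $\Theta_n$ contains the ball with centre $\boldsymbol\beta_0$ and radius $K\sqrt{p_n/|D_n|}$ for all large $n$, then $\hat{\boldsymbol\beta}\in\Theta_n$ with probability tending to $1$. -/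

import Mathlib

open MeasureTheory Filter Topology Set
open scoped ENNReal Pointwise

/-- The observation space `ℝᵈ` with its Euclidean norm and Lebesgue measure. -/
abbrev Space (d : ℕ) : Type := EuclideanSpace ℝ (Fin d)

/-- A (simple) spatial point process on `ℝᵈ`: a locally finite random subset of `ℝᵈ`, random in the
sense that the number of points in every Borel set is a random variable. -/
structure PointProcess (Ω : Type*) [MeasurableSpace Ω] (d : ℕ) where
  /-- the realization of the process -/
  pts : Ω → Set (Space d)
  locallyFinite : ∀ (ω : Ω) (K : Set (Space d)), IsCompact K → (pts ω ∩ K).Finite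
  measurable_count : ∀ B : Set (Space d), MeasurableSet B →
    Measurable fun ω => (pts ω ∩ B).encard

namespace PointProcess

variable {Ω : Type*} [MeasurableSpace Ω] {d : ℕ}

/-- `ρ` is the intensity function of `X` (first-order Campbell formula). -/
def HasIntensity (X : PointProcess Ω d) (μ : Measure Ω) (ρ : Space d → ℝ) : Prop :=
  Measurable ρ ∧ (∀ u, 0 ≤ ρ u) ∧
    ∀ f : Space d → ℝ≥0∞, Measurable f →
      ∫⁻ ω, ∑' u : X.pts ω, f u ∂μ = ∫⁻ u, f u * ENNReal.ofReal (ρ u)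

/-- `ρk` is the product density of order `k` of `X`: the Campbell formula for sums over `k`-tuples
of pairwise distinct points of `X`. -/
def HasProductDensity (X : PointProcess Ω d) (μ : Measure Ω) (k : ℕ)
    (ρk : (Fin k → Space d) → ℝ) : Prop :=
  Measurable ρk ∧ (∀ v, 0 ≤ ρk v) ∧
    ∀ f : (Fin k → Space d) → ℝ≥0∞, Measurable f →
      ∫⁻ ω, ∑' v : {v : Fin k → Space d // Function.Injective v ∧ ∀ i, v i ∈ X.pts ω}, f v ∂μ
        = ∫⁻ v, f v * ENNReal.ofReal (ρk v)

/-- The σ-algebra `𝓕(Λ)` generated by `X ∩ Λ`, that is, by the numbers of points of `X` in the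
Borel subsets of `Λ`. -/
@[reducible] noncomputable def sigmaAlgebra (X : PointProcess Ω d) (Λ : Set (Space d)) : MeasurableSpace Ω :=
  ⨆ (B : Set (Space d)) (_ : MeasurableSet B ∧ B ⊆ Λ),
    MeasurableSpace.comap (fun ω => (X.pts ω ∩ B).encard) inferInstance

/-- The strong mixing coefficient `α_{k,l}(q)`, for `k, l ∈ ℕ ∪ {∞}`. -/
noncomputable def mixingCoeff (X : PointProcess Ω d) (μ : Measure Ω) (k l : ℕ∞) (q : ℝ) : ℝ :=
  sSup {a : ℝ | ∃ Λ₁ Λ₂ : Set (Space d), ∃ A B : Set Ω,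
    MeasurableSet Λ₁ ∧ MeasurableSet Λ₂ ∧
    volume Λ₁ ≤ (k : ℝ≥0∞) ∧ volume Λ₂ ≤ (l : ℝ≥0∞) ∧
    (∀ x ∈ Λ₁, ∀ y ∈ Λ₂, q ≤ dist x y) ∧
    MeasurableSet[X.sigmaAlgebra Λ₁] A ∧ MeasurableSet[X.sigmaAlgebra Λ₂] B ∧
    a = |μ.real (A ∩ B) - μ.real A * μ.real B|}

end PointProcess

/-- The observation window `D_n = nE`. -/
def window {d : ℕ} (E : Set (Space d)) (n : ℕ) : Set (Space d) := (n : ℝ) • E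

/-- The volume `|D_n|`. -/
noncomputable def windowVol {d : ℕ} (E : Set (Space d)) (n : ℕ) : ℝ := volume.real (window E n)

/-- The log-linear intensity `ρ(u; β) = exp(z(u)ᵀ β)` built on the first `p` covariates. -/
noncomputable def intensity {d : ℕ} (z : ℕ → Space d → ℝ) {p : ℕ} (u : Space d)
    (β : EuclideanSpace ℝ (Fin p)) : ℝ :=
  Real.exp (∑ j : Fin p, z j u * β j)

/-- The true parameter `β₀ = (β₀₁ᵀ, 0ᵀ)ᵀ ∈ ℝᵖ`: the `s` coefficients `b` followed by zeros. -/
noncomputable def trueParam {s : ℕ} (b : Fin s → ℝ) (p : ℕ) : EuclideanSpace ℝ (Fin p) :=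
  WithLp.toLp 2 fun j : Fin p => if h : (j : ℕ) < s then b ⟨j, h⟩ else 0

/-- The weighted Poisson likelihood on the window `D` for the point pattern `x`. -/
noncomputable def logLik {d : ℕ} (z : ℕ → Space d → ℝ) (w : Space d → ℝ) (D x : Set (Space d))
    {p : ℕ} (β : EuclideanSpace ℝ (Fin p)) : ℝ :=
  (∑ᶠ u ∈ x ∩ D, w u * Real.log (intensity z u β)) - ∫ u in D, w u * intensity z u β

/-- The penalized weighted Poisson likelihood
`Q(w; β) = ℓ(w; β) - |D| ∑ⱼ p_{λⱼ}(|βⱼ|)`. -/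
noncomputable def penLogLik {d : ℕ} (z : ℕ → Space d → ℝ) (w : Space d → ℝ)
    (pen : ℝ → ℝ → ℝ) (lam : ℕ → ℝ) (D x : Set (Space d))
    {p : ℕ} (β : EuclideanSpace ℝ (Fin p)) : ℝ :=
  logLik z w D x β - volume.real D * ∑ j : Fin p, pen (lam j) |β j|

/-- The matrix `A(w; β) = ∫_D w(u) z(u) z(u)ᵀ ρ(u; β) du`. -/
noncomputable def sensitivity {d : ℕ} (z : ℕ → Space d → ℝ) (w : Space d → ℝ)
    (D : Set (Space d)) {p : ℕ} (β : EuclideanSpace ℝ (Fin p)) : Matrix (Fin p) (Fin p) ℝ :=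
  Matrix.of fun i j => ∫ u in D, w u * (z i u * z j u) * intensity z u β

/-- The smallest (real) eigenvalue of a square matrix; used for symmetric matrices. -/
noncomputable def minEigenvalue {p : ℕ} (M : Matrix (Fin p) (Fin p) ℝ) : ℝ :=
  sInf (spectrum ℝ M)

/-- `p_λ`, `λ ≥ 0`, is a family of penalty functions on `[0, ∞)`: `p_λ` is nonnegative, vanishes at
`0`, and is continuously differentiable on `(0, ∞)` with a Lipschitz derivative there. -/
structure IsPenaltyFamily (pen : ℝ → ℝ → ℝ) : Prop where
  zero : ∀ l, 0 ≤ l → pen l 0 = 0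
  nonneg : ∀ l, 0 ≤ l → ∀ θ, 0 ≤ θ → 0 ≤ pen l θ
  contDiffOn : ∀ l, 0 ≤ l → ContDiffOn ℝ 1 (pen l) (Ioi 0)
  lipschitz_deriv : ∀ l, 0 ≤ l → ∃ L, LipschitzOnWith L (deriv (pen l)) (Ioi 0)

/-- `a_n = max_{j ≤ s} |p'_{λ_{n,j}}(|β₀ⱼ|)|` (zero if `s = 0`). -/
noncomputable def aSeq (pen : ℝ → ℝ → ℝ) (lam : ℕ → ℕ → ℝ) {s : ℕ} (b : Fin s → ℝ) (n : ℕ) : ℝ :=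
  ⨆ j : Fin s, |deriv (pen (lam n j)) (|b j|)|

/-- `c_n = max_{j ≤ s} |p''_{λ_{n,j}}(|β₀ⱼ|)|` (zero if `s = 0`). -/
noncomputable def cSeq (pen : ℝ → ℝ → ℝ) (lam : ℕ → ℕ → ℝ) {s : ℕ} (b : Fin s → ℝ) (n : ℕ) : ℝ :=
  ⨆ j : Fin s, |iteratedDeriv 2 (pen (lam n j)) (|b j|)|

/-- `Y_n = O_P(x_n)`. -/
def IsBigOP {Ω : Type*} [MeasurableSpace Ω] (μ : Measure Ω) (Y : ℕ → Ω → ℝ) (x : ℕ → ℝ) : Prop :=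
  ∀ ε : ℝ, 0 < ε → ∃ K : ℝ, 0 < K ∧
    ∀ᶠ n in atTop, μ {ω | K * |x n| < |Y n ω|} ≤ ENNReal.ofReal ε

/- Let `e_n = √(p_n / |D_n|)` and let `βhat n` be a measurable maximizer of `Q_n` on the closed ball
of radius `k_n e_n` around the true parameter, where `k_n → ∞` so slowly that `log ρ` varies by at
most `1` and the penalties are nearly quadratic on the ball. There the likelihood has curvature at
least of order `|D_n|`, so the distance of `βhat n` to the true parameter is of order at most
`‖score‖ / |D_n| + a_n`. Cutting `ℝᵈ` into unit cells and bounding covariances between cells by the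
mixing coefficient, each component of the score has variance `O(|D_n|)`, whence
`‖score‖ = O_P(√(p_n |D_n|))` and the distance is `O_P(e_n)`. It is then smaller than `k_n e_n` with
probability tending to one, so that `βhat n` is interior to the ball and a local maximizer. -/

section StochasticOrder

lemma exists_tendsto_atTop_eventually {P : ℕ → ℕ → Prop} (hP : ∀ k, ∀ᶠ n in atTop, P k n) :
    ∃ k : ℕ → ℕ, Tendsto k atTop atTop ∧ ∀ᶠ n in atTop, P (k n) n := by
  classical
  have hN : ∀ k, ∃ N, ∀ n ≥ N, P k n := fun k => eventually_atTop.1 (hP k)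
  refine ⟨fun n => Nat.findGreatest (fun k => ∀ m ≥ n, P k m) n,
    tendsto_atTop.2 fun k => ?_, ?_⟩
  · obtain ⟨N, h⟩ := hN k
    filter_upwards [eventually_ge_atTop N, eventually_ge_atTop k] with n hn hk
    exact Nat.le_findGreatest hk fun m hm => h m (hn.trans hm)
  · obtain ⟨N, h⟩ := hN 0
    filter_upwards [eventually_ge_atTop N] with n hn
    exact Nat.findGreatest_spec (P := fun k => ∀ m ≥ n, P k m) n.zero_le
      (fun m hm => h m (hn.trans hm)) n le_rfl

namespace IsBigOP

variable {Ω : Type*} [MeasurableSpace Ω] {μ : Measure Ω} {Y Y' : ℕ → Ω → ℝ} {x x' : ℕ → ℝ}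

lemma of_integral_sq_le {C : ℝ} (hY : ∀ᶠ n in atTop, Integrable (fun ω => Y n ω ^ 2) μ)
    (hC : ∀ᶠ n in atTop, ∫ ω, Y n ω ^ 2 ∂μ ≤ C * x n ^ 2) (hx : ∀ᶠ n in atTop, x n ≠ 0) :
    IsBigOP μ Y x := by
  intro ε hε
  have hK : 0 < √(|C| / ε + 1) := by positivity
  refine ⟨√(|C| / ε + 1), hK, ?_⟩
  filter_upwards [hY, hC, hx] with n hY hC hx
  set c : ℝ := (|C| / ε + 1) * x n ^ 2 with hc
  have hc0 : 0 < c := by positivity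
  have hsub : {ω | √(|C| / ε + 1) * |x n| < |Y n ω|} ⊆
      {ω | ENNReal.ofReal c ≤ ENNReal.ofReal (Y n ω ^ 2)} := by
    intro ω (hω : √(|C| / ε + 1) * |x n| < |Y n ω|)
    refine ENNReal.ofReal_le_ofReal ?_
    have := pow_le_pow_left₀ (by positivity) hω.le 2
    rwa [mul_pow, Real.sq_sqrt (by positivity), sq_abs, sq_abs] at this
  calc μ {ω | √(|C| / ε + 1) * |x n| < |Y n ω|}
      ≤ (∫⁻ ω, ENNReal.ofReal (Y n ω ^ 2) ∂μ) / ENNReal.ofReal c :=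
        (measure_mono hsub).trans (meas_ge_le_lintegral_div
          hY.aestronglyMeasurable.aemeasurable.ennreal_ofReal
          (by simpa using hc0) ENNReal.ofReal_ne_top)
    _ = ENNReal.ofReal ((∫ ω, Y n ω ^ 2 ∂μ) / c) := by
        rw [← ofReal_integral_eq_lintegral_ofReal hY (ae_of_all _ fun ω => sq_nonneg _),
          ENNReal.ofReal_div_of_pos hc0]
    _ ≤ ENNReal.ofReal ε := by
        refine ENNReal.ofReal_le_ofReal ((div_le_iff₀ hc0).2 (hC.trans ?_))
        calc C * x n ^ 2 ≤ (|C| + ε) * x n ^ 2 := by gcongr; linarith [le_abs_self C]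
          _ = ε * c := by rw [hc]; field_simp

lemma of_forall_imp_le (hY : IsBigOP μ Y x)
    (h : ∀ L > 0, ∃ L' > 0, ∀ᶠ n in atTop, ∀ ω, |Y n ω| ≤ L * |x n| → |Y' n ω| ≤ L' * |x' n|) :
    IsBigOP μ Y' x' := by
  intro ε hε
  obtain ⟨L, hL, hYL⟩ := hY ε hε
  obtain ⟨L', hL', hLL'⟩ := h L hL
  refine ⟨L', hL', ?_⟩
  filter_upwards [hYL, hLL'] with n hn hn'
  exact (measure_mono fun ω hω => lt_of_not_ge fun hle => hω.not_ge (hn' ω hle)).trans hn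

lemma mono (hY : IsBigOP μ Y x) (h : ∀ᶠ n in atTop, |x n| ≤ |x' n|) : IsBigOP μ Y x' :=
  hY.of_forall_imp_le fun L hL => ⟨L, hL, by
    filter_upwards [h] with n hn ω hω using hω.trans (by gcongr)⟩

lemma tendsto_measure_zero (hY : IsBigOP μ Y x) {A : ℕ → Set Ω}
    (hA : ∀ L > 0, ∀ᶠ n in atTop, ∀ ω ∈ A n, L * |x n| < |Y n ω|) :
    Tendsto (fun n => μ (A n)) atTop (𝓝 0) := by
  refine ENNReal.tendsto_nhds_zero.2 fun ε hε => ?_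
  obtain ⟨δ, hδ, hδε⟩ := ENNReal.lt_iff_exists_nnreal_btwn.1 hε
  obtain ⟨L, hL, hYL⟩ := hY δ (by simpa using hδ)
  filter_upwards [hYL, hA L hL] with n hn hAn
  exact (measure_mono fun ω hω => hAn ω hω).trans
    (hn.trans (by simpa using hδε.le))

end IsBigOP

end StochasticOrder

section MeasurableSelection

variable {V T : Type*} [MetricSpace V] [TopologicalSpace T]

lemma exists_continuous_cantorSet_range_eq {K : Set V} (hK : IsCompact K)
    (hne : K.Nonempty) : ∃ ψ : cantorSet → V, Continuous ψ ∧ range ψ = K := by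
  have : Nonempty K := hne.to_subtype
  have : CompactSpace K := isCompact_iff_compactSpace.mp hK
  obtain ⟨g, hgc, hgs⟩ := exists_nat_bool_continuous_surjective_of_compact K
  refine ⟨fun c => g (cantorSetHomeomorphNatToBool c),
    continuous_subtype_val.comp (hgc.comp cantorSetHomeomorphNatToBool.continuous), ?_⟩
  have := (hgs.comp cantorSetHomeomorphNatToBool.surjective).range_comp ((↑) : K → V)
  rwa [Subtype.range_coe] at this

variable [MeasurableSpace V] [BorelSpace V] [MeasurableSpace T] [BorelSpace T]

-- Every compact `K` is a continuous image of the Cantor set, whose order singles out in each fibre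
-- of `R` a least point; this point is measurable because its sublevel sets are projections of
-- closed sets along a compact factor.
lemma exists_measurable_selection_of_isClosed {K : Set V}
    (hK : IsCompact K) {R : Set (V × T)} (hR : IsClosed R) (hne : ∀ τ, ∃ v ∈ K, (v, τ) ∈ R) :
    ∃ φ : T → V, Measurable φ ∧ ∀ τ, φ τ ∈ K ∧ (φ τ, τ) ∈ R := by
  rcases isEmpty_or_nonempty T with hT | ⟨⟨τ₀⟩⟩
  · exact ⟨isEmptyElim, measurable_of_empty _, fun τ => isEmptyElim τ⟩
  obtain ⟨ψ, hψ, hrange⟩ :=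
    exists_continuous_cantorSet_range_eq hK ((hne τ₀).imp fun _ h => h.1)
  have : CompactSpace cantorSet := isCompact_iff_compactSpace.mp isCompact_cantorSet
  have hcl : IsClosed {q : cantorSet × T | (ψ q.1, q.2) ∈ R} := hR.preimage (by fun_prop)
  have hleast : ∀ τ, ∃ c, IsLeast {c | (ψ c, τ) ∈ R} c := fun τ => by
    refine IsCompact.exists_isLeast (hR.preimage (by fun_prop)).isCompact ?_
    obtain ⟨v, hv, hvR⟩ := hne τ
    obtain ⟨c, rfl⟩ := hrange ▸ hv
    exact ⟨c, hvR⟩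
  choose ξ hξ using hleast
  refine ⟨fun τ => ψ (ξ τ), hψ.measurable.comp ?_,
    fun τ => ⟨hrange ▸ mem_range_self _, (hξ τ).1⟩⟩
  refine Measurable.subtype_mk (f := fun τ => (ξ τ : ℝ)) (measurable_of_Iic fun a => ?_)
  have hsub : (fun τ => (ξ τ : ℝ)) ⁻¹' Iic a =
      Prod.snd '' ({q : cantorSet × T | (ψ q.1, q.2) ∈ R} ∩ {q | (q.1 : ℝ) ≤ a}) := by
    ext τ
    simp only [mem_preimage, mem_Iic, mem_image, mem_inter_iff, mem_ofPred_eq, Prod.exists,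
      exists_eq_right]
    exact ⟨fun h => ⟨ξ τ, (hξ τ).1, h⟩, fun ⟨c, h, h'⟩ => le_trans ((hξ τ).2 h) h'⟩
  rw [hsub]
  exact (isClosedMap_snd_of_compactSpace _ (hcl.inter
    (isClosed_le (by fun_prop) continuous_const))).measurableSet

lemma exists_measurable_isMaxOn {K : Set V} (hK : IsCompact K)
    (hne : K.Nonempty) {F : V → T → ℝ} (hF : UpperSemicontinuous fun q : V × T => F q.1 q.2)
    (hFc : ∀ v, Continuous (F v)) :
    ∃ φ : T → V, Measurable φ ∧ ∀ τ, φ τ ∈ K ∧ IsMaxOn (F · τ) K (φ τ) := by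
  have hR : IsClosed (⋂ γ ∈ K, {q : V × T | F γ q.2 ≤ F q.1 q.2}) := by
    refine isClosed_biInter fun γ _ => ?_
    have husc : UpperSemicontinuous fun q : V × T => F q.1 q.2 + -F γ q.2 :=
      hF.add ((hFc γ).comp continuous_snd).neg.upperSemicontinuous
    convert husc.isClosed_preimage 0 using 1
    ext q
    simp [← sub_eq_add_neg]
  obtain ⟨φ, hφ, h⟩ := exists_measurable_selection_of_isClosed hK hR fun τ => by
    have husc : UpperSemicontinuousOn (F · τ) K :=
      (hF.comp (g := fun v : V => (v, τ)) (by fun_prop)).upperSemicontinuousOn _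
    obtain ⟨v, hv, hmax⟩ := husc.exists_isMaxOn hne hK
    exact ⟨v, hv, mem_iInter₂.2 hmax⟩
  exact ⟨φ, hφ, fun τ => ⟨(h τ).1, fun γ hγ => mem_iInter₂.1 (h τ).2 γ hγ⟩⟩

end MeasurableSelection

section Covariance

variable {Ω : Type*} [MeasurableSpace Ω] {μ : Measure Ω} {X Y : Ω → ℝ} {T : ℝ}

lemma min_eq_setIntegral_indicator {x : ℝ} (hT : 0 ≤ T) (hx : 0 ≤ x) :
    min x T = ∫ s in Ioc 0 T, (Iio x).indicator (fun _ => (1 : ℝ)) s := by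
  have h : (Ioc 0 T ∩ Iio x : Set ℝ) =ᵐ[volume] Ioo 0 (min x T) := by
    have heq : Ioo 0 T ∩ Iio x = Ioo 0 (min x T) := by
      ext y
      simp only [mem_inter_iff, mem_Ioo, mem_Iio, lt_min_iff]
      tauto
    exact heq ▸ Ioo_ae_eq_Ioc.symm.inter (ae_eq_refl (Iio x))
  rw [setIntegral_indicator measurableSet_Iio, setIntegral_const, measureReal_congr h,
    Real.volume_real_Ioo_of_le (le_min hx hT), sub_zero, smul_eq_mul, mul_one]

lemma integral_min_mul_min_eq [IsFiniteMeasure μ] (hX : Measurable X) (hY : Measurable Y)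
    (hX0 : ∀ ω, 0 ≤ X ω) (hY0 : ∀ ω, 0 ≤ Y ω) (hT : 0 ≤ T) :
    IntegrableOn (fun q : ℝ × ℝ => μ.real ({ω | q.1 < X ω} ∩ {ω | q.2 < Y ω}))
      (Ioc 0 T ×ˢ Ioc 0 T) ∧
    ∫ ω, min (X ω) T * min (Y ω) T ∂μ
      = ∫ q in Ioc 0 T ×ˢ Ioc 0 T, μ.real ({ω | q.1 < X ω} ∩ {ω | q.2 < Y ω}) := by
  have hfin : IsFiniteMeasure ((volume : Measure (ℝ × ℝ)).restrict (Ioc 0 T ×ˢ Ioc 0 T)) :=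
    ⟨by simp [Measure.volume_eq_prod, ENNReal.mul_lt_top]⟩
  set S : Set (Ω × ℝ × ℝ) := {a | a.2.1 < X a.1} ∩ {a | a.2.2 < Y a.1} with hS
  have hint : Integrable (S.indicator fun _ => (1 : ℝ))
      (μ.prod (volume.restrict (Ioc 0 T ×ˢ Ioc 0 T))) :=
    (integrable_const _).indicator ((measurableSet_lt (by fun_prop) (by fun_prop)).inter
      (measurableSet_lt (by fun_prop) (by fun_prop)))
  have hfst : ∀ q : ℝ × ℝ, ∫ ω, S.indicator (fun _ => (1 : ℝ)) (ω, q) ∂μ =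
      μ.real ({ω | q.1 < X ω} ∩ {ω | q.2 < Y ω}) := fun q =>
    integral_indicator_one (s := {ω | q.1 < X ω} ∩ {ω | q.2 < Y ω})
      ((measurableSet_lt measurable_const hX).inter (measurableSet_lt measurable_const hY))
  have hsnd : ∀ ω, min (X ω) T * min (Y ω) T =
      ∫ q in Ioc 0 T ×ˢ Ioc 0 T, S.indicator (fun _ => (1 : ℝ)) (ω, q) := fun ω => by
    rw [min_eq_setIntegral_indicator hT (hX0 ω), min_eq_setIntegral_indicator hT (hY0 ω),
      ← setIntegral_prod_mul]
    congr 1 with q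
    by_cases h₁ : q.1 < X ω <;> by_cases h₂ : q.2 < Y ω <;> simp [hS, h₁, h₂]
  constructor
  · exact hint.integral_prod_right.congr (ae_of_all _ hfst)
  · simp_rw [hsnd, ← hfst]
    exact integral_integral_swap (f := fun ω q => S.indicator (fun _ => (1 : ℝ)) (ω, q)) hint

lemma mul_sub_min_mul_min_mem_Icc {x y : ℝ} (hT : 0 < T) (hx : 0 ≤ x) (hy : 0 ≤ y) (t : ℕ) :
    x * y - min x T * min y T ∈ Icc 0 ((x ^ (2 + t) + y ^ (2 + t)) / T ^ t) := by
  have h0 : min x T * min y T ≤ x * y :=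
    mul_le_mul (min_le_left _ _) (min_le_left _ _) (le_min hy hT.le) hx
  refine ⟨by linarith, ?_⟩
  have hpow : ∀ m : ℝ, T ≤ m → m * m ≤ m ^ (2 + t) / T ^ t := fun m hm => by
    rw [le_div_iff₀ (by positivity), pow_add, sq]
    exact mul_le_mul_of_nonneg_left (pow_le_pow_left₀ hT.le hm t) (mul_self_nonneg m)
  rw [add_div]
  have hxt : 0 ≤ x ^ (2 + t) / T ^ t := by positivity
  have hyt : 0 ≤ y ^ (2 + t) / T ^ t := by positivity
  have hn : 0 ≤ min x T * min y T := by positivity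
  rcases le_total x T with h₁ | h₁ <;> rcases le_total y T with h₂ | h₂
  · rw [min_eq_left h₁, min_eq_left h₂, sub_self]
    positivity
  · nlinarith [hpow y h₂]
  · nlinarith [hpow x h₁]
  · nlinarith [hpow x h₁, hpow y h₂, sq_nonneg (x - y)]

lemma integral_mul_sub_integral_min_mul_min_mem_Icc [IsFiniteMeasure μ] (hX : Measurable X)
    (hY : Measurable Y) (hX0 : ∀ ω, 0 ≤ X ω) (hY0 : ∀ ω, 0 ≤ Y ω) {t : ℕ}
    (iX : Integrable (fun ω => X ω ^ (2 + t)) μ) (iY : Integrable (fun ω => Y ω ^ (2 + t)) μ)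
    (hT : 0 < T) :
    ∫ ω, X ω * Y ω ∂μ - ∫ ω, min (X ω) T * min (Y ω) T ∂μ ∈
      Icc 0 ((∫ ω, X ω ^ (2 + t) ∂μ + ∫ ω, Y ω ^ (2 + t) ∂μ) / T ^ t) := by
  have hmem := fun ω => mul_sub_min_mul_min_mem_Icc hT (hX0 ω) (hY0 ω) t
  have hdom := (iX.add iY).div_const (T ^ t)
  have hdiff : Integrable (fun ω => X ω * Y ω - min (X ω) T * min (Y ω) T) μ :=
    hdom.mono' (by fun_prop) <| ae_of_all _ fun ω => by
      rw [Real.norm_of_nonneg (hmem ω).1]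
      exact (hmem ω).2
  have hmin : Integrable (fun ω => min (X ω) T * min (Y ω) T) μ :=
    (integrable_const (T * T)).mono' (by fun_prop) <| ae_of_all _ fun ω => by
      have h₁ : 0 ≤ min (X ω) T := le_min (hX0 ω) hT.le
      have h₂ : 0 ≤ min (Y ω) T := le_min (hY0 ω) hT.le
      rw [Real.norm_of_nonneg (mul_nonneg h₁ h₂)]
      exact mul_le_mul (min_le_right _ _) (min_le_right _ _) h₂ hT.le
  have hprod : Integrable (fun ω => X ω * Y ω) μ :=
    (hdiff.add hmin).congr <| ae_of_all _ fun ω => by simp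
  rw [← integral_sub hprod hmin, ← integral_add iX iY, ← integral_div]
  exact ⟨integral_nonneg fun ω => (hmem ω).1, integral_mono hdiff hdom fun ω => (hmem ω).2⟩

-- Hoeffding's identity writes the covariance of the truncated variables as the integral over
-- `(0, T]²` of the mixing defect of their tail events.
lemma abs_integral_min_mul_min_sub_le [IsProbabilityMeasure μ] (hX : Measurable X)
    (hY : Measurable Y) (hX0 : ∀ ω, 0 ≤ X ω) (hY0 : ∀ ω, 0 ≤ Y ω) (hT : 0 ≤ T) {α : ℝ}
    (hα : ∀ a b, |μ.real ({ω | a < X ω} ∩ {ω | b < Y ω}) -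
      μ.real {ω | a < X ω} * μ.real {ω | b < Y ω}| ≤ α) :
    |∫ ω, min (X ω) T * min (Y ω) T ∂μ -
      ∫ ω, min (X ω.1) T * min (Y ω.2) T ∂(μ.prod μ)| ≤ α * T ^ 2 := by
  obtain ⟨i₁, e₁⟩ := integral_min_mul_min_eq (μ := μ) hX hY hX0 hY0 hT
  obtain ⟨i₂, e₂⟩ := integral_min_mul_min_eq (μ := μ.prod μ) (hX.comp measurable_fst)
    (hY.comp measurable_snd) (fun ω => hX0 ω.1) (fun ω => hY0 ω.2) hT
  have hprod : ∀ a b, (μ.prod μ).real ({ω | a < X ω.1} ∩ {ω | b < Y ω.2}) =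
      μ.real {ω | a < X ω} * μ.real {ω | b < Y ω} := fun a b => by
    rw [← measureReal_prod_prod]
    rfl
  have hvol : (volume : Measure (ℝ × ℝ)) (Ioc 0 T ×ˢ Ioc 0 T) = ENNReal.ofReal (T ^ 2) := by
    rw [Measure.volume_eq_prod, Measure.prod_prod, Real.volume_Ioc, sub_zero,
      ← ENNReal.ofReal_mul hT, sq]
  simp only [Function.comp_apply, hprod] at i₂ e₂
  rw [e₁, e₂, ← integral_sub i₁ i₂]
  have := norm_setIntegral_le_of_norm_le_const (μ := (volume : Measure (ℝ × ℝ)))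
    (s := Ioc 0 T ×ˢ Ioc 0 T) (f := fun q => μ.real ({ω | q.1 < X ω} ∩ {ω | q.2 < Y ω}) -
      μ.real {ω | q.1 < X ω} * μ.real {ω | q.2 < Y ω})
    (by rw [hvol]; exact ENNReal.ofReal_lt_top) (fun q _ => hα q.1 q.2)
  rwa [measureReal_def, hvol, ENNReal.toReal_ofReal (sq_nonneg T)] at this

-- A form of Davydov's inequality; the truncation level `T` is left to be optimized.
lemma abs_covariance_le_of_mixing [IsProbabilityMeasure μ] (hX : Measurable X)
    (hY : Measurable Y) (hX0 : ∀ ω, 0 ≤ X ω) (hY0 : ∀ ω, 0 ≤ Y ω) {t : ℕ} {α C : ℝ}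
    (iX : MemLp X ((2 + t : ℕ) : ℝ≥0∞) μ) (iY : MemLp Y ((2 + t : ℕ) : ℝ≥0∞) μ)
    (bX : ∫ ω, X ω ^ (2 + t) ∂μ ≤ C) (bY : ∫ ω, Y ω ^ (2 + t) ∂μ ≤ C)
    (hα : ∀ a b, |μ.real ({ω | a < X ω} ∩ {ω | b < Y ω}) -
      μ.real {ω | a < X ω} * μ.real {ω | b < Y ω}| ≤ α) (hT : 0 < T) :
    |ProbabilityTheory.covariance X Y μ| ≤ α * T ^ 2 + 2 * C / T ^ t := by
  have jX : Integrable (fun ω => X ω ^ (2 + t)) μ := by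
    simpa only [Real.norm_of_nonneg (hX0 _)] using iX.integrable_norm_pow (by omega)
  have jY : Integrable (fun ω => Y ω ^ (2 + t)) μ := by
    simpa only [Real.norm_of_nonneg (hY0 _)] using iY.integrable_norm_pow (by omega)
  have h2 : (2 : ℝ≥0∞) ≤ ((2 + t : ℕ) : ℝ≥0∞) := by exact_mod_cast Nat.le_add_right 2 t
  have hcov : ProbabilityTheory.covariance X Y μ =
      ∫ ω, X ω * Y ω ∂μ - ∫ ω, X ω.1 * Y ω.2 ∂(μ.prod μ) := by
    rw [integral_prod_mul, ProbabilityTheory.covariance_eq_sub (iX.mono_exponent h2)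
      (iY.mono_exponent h2)]
    rfl
  have htrunc := abs_le.1 (abs_integral_min_mul_min_sub_le hX hY hX0 hY0 hT.le hα)
  have hjoint := integral_mul_sub_integral_min_mul_min_mem_Icc hX hY hX0 hY0 jX jY hT
  have hprod := integral_mul_sub_integral_min_mul_min_mem_Icc (μ := μ.prod μ)
    (hX.comp measurable_fst) (hY.comp measurable_snd) (fun ω => hX0 ω.1) (fun ω => hY0 ω.2)
    (jX.comp_fst μ) (jY.comp_snd μ) hT
  have hfst : ∫ ω, X ω.1 ^ (2 + t) ∂(μ.prod μ) = ∫ ω, X ω ^ (2 + t) ∂μ := by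
    simpa using integral_fun_fst (μ := μ) (ν := μ) fun ω => X ω ^ (2 + t)
  have hsnd : ∫ ω, Y ω.2 ^ (2 + t) ∂(μ.prod μ) = ∫ ω, Y ω ^ (2 + t) ∂μ := by
    simpa using integral_fun_snd (μ := μ) (ν := μ) fun ω => Y ω ^ (2 + t)
  simp only [Function.comp_apply, hfst, hsnd] at hprod
  have hC : (∫ ω, X ω ^ (2 + t) ∂μ + ∫ ω, Y ω ^ (2 + t) ∂μ) / T ^ t ≤ 2 * C / T ^ t := by
    gcongr
    linarith
  rw [hcov, abs_le]
  constructor <;> linarith [hjoint.1, hjoint.2, hprod.1, hprod.2]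

end Covariance

lemma tsum_indicator_const {α : Type*} (s B : Set α) (c : ℝ≥0∞) :
    ∑' u : s, B.indicator (fun _ => c) (u : α) = (s ∩ B).encard * c := by
  rw [← ENNReal.tsum_set_const, tsum_subtype s (B.indicator fun _ => c), indicator_indicator,
    tsum_subtype (s ∩ B) fun _ => c]

lemma tsum_injective_indicator_pi {α : Type*} {s B : Set α} (hB : (s ∩ B).Finite) (r : ℕ) :
    ∑' v : {v : Fin r → α // Function.Injective v ∧ ∀ i, v i ∈ s},
        (univ.pi fun _ : Fin r => B).indicator (fun _ => (1 : ℝ≥0∞)) (v : Fin r → α) =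
      ((s ∩ B).ncard.descFactorial r : ℕ) := by
  classical
  have := hB.fintype
  have hrange : {v : Fin r → α | Function.Injective v ∧ ∀ i, v i ∈ s} ∩
      (univ.pi fun _ : Fin r => B) = range fun e : Fin r ↪ ↥(s ∩ B) => fun i => (e i : α) := by
    ext v
    constructor
    · rintro ⟨⟨hinj, hs⟩, hvB⟩
      exact ⟨⟨fun i => ⟨v i, hs i, hvB i (mem_univ i)⟩,
        fun i j hij => hinj (congrArg Subtype.val hij)⟩, rfl⟩
    · rintro ⟨e, rfl⟩
      exact ⟨⟨fun i j hij => e.injective (Subtype.ext hij), fun i => (e i).2.1⟩,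
        fun i _ => (e i).2.2⟩
  have hinj : Function.Injective fun e : Fin r ↪ ↥(s ∩ B) => fun i => (e i : α) :=
    fun e e' h => by
      ext i : 2
      exact congrFun h i
  refine (tsum_indicator_const {v : Fin r → α | Function.Injective v ∧ ∀ i, v i ∈ s}
    (univ.pi fun _ => B) 1).trans ?_
  rw [mul_one, hrange, ← image_univ, hinj.injOn.encard_image, encard_univ,
    ENat.card_eq_coe_fintype_card, Fintype.card_embedding_eq, ncard_eq_toFinset_card',
    toFinset_card, Fintype.card_fin]
  simp

lemma pow_le_add_descFactorial (n r : ℕ) : n ^ r ≤ (2 * r) ^ r + 2 ^ r * n.descFactorial r := by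
  rcases le_total n (2 * r) with h | h
  · exact (Nat.pow_le_pow_left h r).trans (Nat.le_add_right _ _)
  · calc n ^ r ≤ (2 * (n + 1 - r)) ^ r := Nat.pow_le_pow_left (by omega) r
      _ = 2 ^ r * (n + 1 - r) ^ r := mul_pow _ _ _
      _ ≤ 2 ^ r * n.descFactorial r := by gcongr; exact Nat.pow_sub_le_descFactorial n r
      _ ≤ _ := Nat.le_add_left _ _

namespace PointProcess

variable {Ω : Type*} [MeasurableSpace Ω] {d : ℕ} (X : PointProcess Ω d) {μ : Measure Ω}
  {B : Set (Space d)} {f : Space d → ℝ}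

lemma sigmaAlgebra_le (Λ : Set (Space d)) : X.sigmaAlgebra Λ ≤ ‹MeasurableSpace Ω› :=
  iSup₂_le fun B hB => (X.measurable_count B hB.1).comap_le

lemma measurable_encard_sigmaAlgebra {Λ : Set (Space d)} (hB : MeasurableSet B) (hBΛ : B ⊆ Λ) :
    Measurable[X.sigmaAlgebra Λ] fun ω => (X.pts ω ∩ B).encard :=
  Measurable.mono (comap_measurable _) (le_iSup₂_of_le B ⟨hB, hBΛ⟩ le_rfl) le_rfl

lemma measurable_tsum_indicator {Λ : Set (Space d)} (hΛ : MeasurableSet Λ)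
    {g : Space d → ℝ≥0∞} (hg : Measurable g) :
    Measurable[X.sigmaAlgebra Λ] fun ω => ∑' u : X.pts ω, Λ.indicator g u := by
  refine Measurable.ennreal_induction (motive := fun g => Measurable[X.sigmaAlgebra Λ]
    fun ω => ∑' u : X.pts ω, Λ.indicator g u) (fun c s hs => ?_) (fun g h _ _ _ hg hh => ?_)
    (fun g _ hmono hg => ?_) hg
  · simp_rw [indicator_indicator, tsum_indicator_const]
    exact Measurable.comp (g := fun k : ℕ∞ => (k : ℝ≥0∞) * c) (measurable_of_countable _)
      (X.measurable_encard_sigmaAlgebra (hΛ.inter hs) inter_subset_left)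
  · convert hg.add hh using 2 with ω
    simp only [Pi.add_apply, indicator_add']
    exact ENNReal.tsum_add
  · convert Measurable.iSup hg using 2 with ω
    have hsup : ∀ u, Λ.indicator (fun x => ⨆ n, g n x) u = ⨆ n, Λ.indicator (g n) u := by
      intro u
      by_cases hu : u ∈ Λ <;> simp [hu]
    simp_rw [hsup, ENNReal.tsum_eq_iSup_sum]
    rw [iSup_comm]
    exact iSup_congr fun s => ENNReal.finsetSum_iSup_of_monotone fun u m n hmn =>
      indicator_le_indicator (hmono hmn _)

lemma finite_inter (hB : Bornology.IsBounded B) (ω : Ω) : (X.pts ω ∩ B).Finite :=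
  (X.locallyFinite ω _ hB.isCompact_closure).subset (inter_subset_inter_right _ subset_closure)

/-- The linear statistic `∑_{u ∈ X ∩ B} f u`; the sum is a `finsum`, so it is only meaningful when
`X ∩ B` is finite, for instance for bounded `B`. -/
noncomputable def linStat (B : Set (Space d)) (f : Space d → ℝ) (ω : Ω) : ℝ :=
  ∑ᶠ u ∈ X.pts ω ∩ B, f u

lemma linStat_eq_sum (hB : Bornology.IsBounded B) (f : Space d → ℝ) (ω : Ω) :
    X.linStat B f ω = ∑ u ∈ (X.finite_inter hB ω).toFinset, f u :=
  finsum_mem_eq_finite_toFinset_sum f _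

lemma linStat_nonneg (B : Set (Space d)) (hf : ∀ u, 0 ≤ f u) (ω : Ω) : 0 ≤ X.linStat B f ω :=
  finsum_nonneg fun u => finsum_nonneg fun _ => hf u

lemma abs_linStat_le (hB : Bornology.IsBounded B) {K : ℝ} (hK : ∀ u, |f u| ≤ K) (ω : Ω) :
    |X.linStat B f ω| ≤ K * (X.pts ω ∩ B).ncard := by
  rw [X.linStat_eq_sum hB, ncard_eq_toFinset_card _ (X.finite_inter hB ω), mul_comm,
    ← nsmul_eq_mul]
  exact (Finset.abs_sum_le_sum_abs _ _).trans (Finset.sum_le_card_nsmul _ _ _ fun u _ => hK u)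

lemma linStat_eq_sub (hB : Bornology.IsBounded B) (f : Space d → ℝ) :
    X.linStat B f =
      fun ω => X.linStat B (fun u => max (f u) 0) ω - X.linStat B (fun u => max (-f u) 0) ω := by
  ext ω
  simp only [X.linStat_eq_sum hB, ← Finset.sum_sub_distrib, max_zero_sub_max_neg_zero_eq_self]

lemma ofReal_linStat (hB : Bornology.IsBounded B) (hf : ∀ u, 0 ≤ f u) (ω : Ω) :
    ENNReal.ofReal (X.linStat B f ω) =
      ∑' u : X.pts ω, B.indicator (fun u => ENNReal.ofReal (f u)) (u : Space d) := by
  rw [X.linStat_eq_sum hB, ENNReal.ofReal_sum_of_nonneg fun u _ => hf u,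
    tsum_subtype (X.pts ω) (B.indicator fun u => ENNReal.ofReal (f u)), indicator_indicator,
    tsum_eq_sum (s := (X.finite_inter hB ω).toFinset)]
  · refine Finset.sum_congr rfl fun u hu => ?_
    rw [indicator_of_mem (by simpa using hu)]
  · intro u hu
    exact indicator_of_notMem (by simpa using hu) _

lemma measurable_linStat_sigmaAlgebra (hB : Bornology.IsBounded B) (hBm : MeasurableSet B)
    (hfm : Measurable f) : Measurable[X.sigmaAlgebra B] (X.linStat B f) := by
  have hnonneg : ∀ g : Space d → ℝ, Measurable g → (∀ u, 0 ≤ g u) →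
      Measurable[X.sigmaAlgebra B] (X.linStat B g) := fun g hgm hg => by
    have h := (X.measurable_tsum_indicator hBm hgm.ennreal_ofReal).ennreal_toReal
    simpa only [← X.ofReal_linStat hB hg, ENNReal.toReal_ofReal (X.linStat_nonneg B hg _)] using h
  rw [X.linStat_eq_sub hB]
  exact (hnonneg _ (by fun_prop) fun u => le_max_right _ _).sub
    (hnonneg _ (by fun_prop) fun u => le_max_right _ _)

lemma measurable_linStat (hB : Bornology.IsBounded B) (hBm : MeasurableSet B)
    (hfm : Measurable f) : Measurable (X.linStat B f) :=
  (X.measurable_linStat_sigmaAlgebra hB hBm hfm).mono (X.sigmaAlgebra_le B) le_rfl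

section Campbell

variable {X} {ρ : Space d → ℝ}

lemma HasIntensity.lintegral_ofReal_linStat (hρ : X.HasIntensity μ ρ) (hB : Bornology.IsBounded B)
    (hBm : MeasurableSet B) (hfm : Measurable f) (hf : ∀ u, 0 ≤ f u) :
    ∫⁻ ω, ENNReal.ofReal (X.linStat B f ω) ∂μ = ∫⁻ u in B, ENNReal.ofReal (f u * ρ u) := by
  simp_rw [X.ofReal_linStat hB hf]
  rw [hρ.2.2 _ (hfm.ennreal_ofReal.indicator hBm), ← lintegral_indicator hBm]
  congr 2 with u
  by_cases hu : u ∈ B <;> simp [hu, ENNReal.ofReal_mul (hf u)]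

lemma HasIntensity.integrable_linStat_and_integral_eq_of_nonneg (hρ : X.HasIntensity μ ρ)
    (hB : Bornology.IsBounded B) (hBm : MeasurableSet B) (hfm : Measurable f) (hf : ∀ u, 0 ≤ f u)
    (hfρ : IntegrableOn (fun u => f u * ρ u) B) :
    Integrable (X.linStat B f) μ ∧ ∫ ω, X.linStat B f ω ∂μ = ∫ u in B, f u * ρ u := by
  have hlin := X.measurable_linStat hB hBm hfm
  have hnn : 0 ≤ᵐ[μ] X.linStat B f := ae_of_all _ (X.linStat_nonneg B hf)
  have hnn' : 0 ≤ᵐ[volume.restrict B] fun u => f u * ρ u :=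
    ae_of_all _ fun u => mul_nonneg (hf u) (hρ.2.1 u)
  have hlint := hρ.lintegral_ofReal_linStat hB hBm hfm hf
  refine ⟨⟨hlin.aestronglyMeasurable, ?_⟩, ?_⟩
  · rw [hasFiniteIntegral_iff_ofReal hnn, hlint, ← hasFiniteIntegral_iff_ofReal hnn']
    exact hfρ.2
  · rw [integral_eq_lintegral_of_nonneg_ae hnn hlin.aestronglyMeasurable, hlint,
      integral_eq_lintegral_of_nonneg_ae hnn' hfρ.1]

lemma HasIntensity.integrable_linStat_and_integral_eq (hρ : X.HasIntensity μ ρ)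
    (hB : Bornology.IsBounded B) (hBm : MeasurableSet B) (hfm : Measurable f)
    (hfρ : IntegrableOn (fun u => f u * ρ u) B) :
    Integrable (X.linStat B f) μ ∧ ∫ ω, X.linStat B f ω ∂μ = ∫ u in B, f u * ρ u := by
  have hpart : ∀ g : Space d → ℝ, Measurable g → (∀ u, |g u| ≤ |f u|) →
      IntegrableOn (fun u => g u * ρ u) B := fun g hgm hg =>
    Integrable.mono hfρ (hgm.mul hρ.1).aestronglyMeasurable <| ae_of_all _ fun u => by
      simp only [norm_mul, Real.norm_eq_abs]
      exact mul_le_mul_of_nonneg_right (hg u) (abs_nonneg _)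
  have hpos := hpart (fun u => max (f u) 0) (by fun_prop) fun u => by
    rw [abs_of_nonneg (le_max_right _ _)]
    exact max_le (le_abs_self _) (abs_nonneg _)
  have hneg := hpart (fun u => max (-f u) 0) (by fun_prop) fun u => by
    rw [abs_of_nonneg (le_max_right _ _)]
    exact max_le (neg_le_abs _) (abs_nonneg _)
  obtain ⟨i₁, e₁⟩ := hρ.integrable_linStat_and_integral_eq_of_nonneg hB hBm (by fun_prop)
    (fun u => le_max_right _ _) hpos
  obtain ⟨i₂, e₂⟩ := hρ.integrable_linStat_and_integral_eq_of_nonneg hB hBm (by fun_prop)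
    (fun u => le_max_right _ _) hneg
  rw [X.linStat_eq_sub hB]
  refine ⟨i₁.sub i₂, ?_⟩
  rw [integral_sub i₁ i₂, e₁, e₂, ← integral_sub hpos hneg]
  simp only [← sub_mul, max_zero_sub_max_neg_zero_eq_self]

end Campbell

section Moments

variable {X} {r : ℕ} {ρr : (Fin r → Space d) → ℝ} {M : ℝ}

lemma HasProductDensity.lintegral_descFactorial_le (hρ : X.HasProductDensity μ r ρr)
    (hM : ∀ v, ρr v ≤ M) (hB : Bornology.IsBounded B) (hBm : MeasurableSet B) :
    ∫⁻ ω, (((X.pts ω ∩ B).ncard.descFactorial r : ℕ) : ℝ≥0∞) ∂μ ≤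
      ENNReal.ofReal M * volume B ^ r := by
  have hpm : MeasurableSet (univ.pi fun _ : Fin r => B) := MeasurableSet.univ_pi fun _ => hBm
  simp_rw [← tsum_injective_indicator_pi (X.finite_inter hB _) r]
  rw [hρ.2.2 _ (measurable_const.indicator hpm)]
  calc _ ≤ ∫⁻ v, (univ.pi fun _ : Fin r => B).indicator (fun _ => ENNReal.ofReal M) v := by
        refine lintegral_mono fun v => ?_
        by_cases h : v ∈ univ.pi fun _ : Fin r => B
        · simpa [h] using ENNReal.ofReal_le_ofReal (hM v)
        · simp [h]
    _ = ENNReal.ofReal M * volume B ^ r := by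
        rw [lintegral_indicator hpm, setLIntegral_const, volume_pi_pi]
        simp

lemma HasProductDensity.lintegral_abs_linStat_pow_le [IsProbabilityMeasure μ]
    (hρ : X.HasProductDensity μ r ρr) (hM : ∀ v, ρr v ≤ M) (hB : Bornology.IsBounded B)
    (hBm : MeasurableSet B) (hvol : volume B ≤ 1) {K : ℝ} (hK : ∀ u, |f u| ≤ K) :
    ∫⁻ ω, ENNReal.ofReal (|X.linStat B f ω| ^ r) ∂μ ≤
      ENNReal.ofReal (K ^ r * ((2 * r) ^ r + 2 ^ r * M)) := by
  have hK0 : 0 ≤ K := (abs_nonneg _).trans (hK 0)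
  have hM0 : 0 ≤ M := (hρ.2.1 0).trans (hM 0)
  have hcount : ∀ ω, |X.linStat B f ω| ^ r ≤
      K ^ r * ((2 * r) ^ r + 2 ^ r * ((X.pts ω ∩ B).ncard.descFactorial r : ℕ)) := fun ω =>
    calc |X.linStat B f ω| ^ r ≤ (K * (X.pts ω ∩ B).ncard) ^ r := by
          gcongr
          exact X.abs_linStat_le hB hK ω
      _ ≤ _ := by
          rw [mul_pow]
          gcongr
          exact_mod_cast pow_le_add_descFactorial _ r
  calc _ ≤ ∫⁻ ω, ENNReal.ofReal (K ^ r) * (ENNReal.ofReal ((2 * r) ^ r) +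
        ENNReal.ofReal (2 ^ r) * (((X.pts ω ∩ B).ncard.descFactorial r : ℕ) : ℝ≥0∞)) ∂μ := by
        refine lintegral_mono fun ω => (ENNReal.ofReal_le_ofReal (hcount ω)).trans_eq ?_
        rw [ENNReal.ofReal_mul (by positivity), ENNReal.ofReal_add (by positivity) (by positivity),
          ENNReal.ofReal_mul (by positivity), ENNReal.ofReal_natCast]
    _ = ENNReal.ofReal (K ^ r) * (ENNReal.ofReal ((2 * r) ^ r) + ENNReal.ofReal (2 ^ r) *
        ∫⁻ ω, (((X.pts ω ∩ B).ncard.descFactorial r : ℕ) : ℝ≥0∞) ∂μ) := by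
        rw [lintegral_const_mul' _ _ ENNReal.ofReal_ne_top, lintegral_add_left measurable_const,
          lintegral_const_mul' _ _ ENNReal.ofReal_ne_top, lintegral_const, measure_univ, mul_one]
    _ ≤ ENNReal.ofReal (K ^ r) * (ENNReal.ofReal ((2 * r) ^ r) +
        ENNReal.ofReal (2 ^ r) * ENNReal.ofReal M) := by
        gcongr
        exact (hρ.lintegral_descFactorial_le hM hB hBm).trans
          (mul_le_of_le_one_right' (pow_le_one₀ (by simp) hvol))
    _ = _ := by
        rw [ENNReal.ofReal_mul (by positivity), ENNReal.ofReal_add (by positivity) (by positivity),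
          ENNReal.ofReal_mul (by positivity)]

lemma HasProductDensity.memLp_linStat_and_integral_le [IsProbabilityMeasure μ]
    (hρ : X.HasProductDensity μ r ρr) (hr : r ≠ 0) (hM : ∀ v, ρr v ≤ M)
    (hB : Bornology.IsBounded B) (hBm : MeasurableSet B) (hvol : volume B ≤ 1) (hfm : Measurable f)
    {K : ℝ} (hK : ∀ u, |f u| ≤ K) :
    MemLp (X.linStat B f) r μ ∧
      ∫ ω, |X.linStat B f ω| ^ r ∂μ ≤ K ^ r * ((2 * r) ^ r + 2 ^ r * M) := by
  have hK0 : 0 ≤ K := (abs_nonneg _).trans (hK 0)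
  have hM0 : 0 ≤ M := (hρ.2.1 0).trans (hM 0)
  have hlin := X.measurable_linStat hB hBm hfm
  have hpow : 0 ≤ᵐ[μ] fun ω => |X.linStat B f ω| ^ r := ae_of_all _ fun ω => by positivity
  have hlint := hρ.lintegral_abs_linStat_pow_le hM hB hBm hvol hK
  constructor
  · rw [← integrable_norm_rpow_iff hlin.aestronglyMeasurable (mod_cast hr) (by simp)]
    simp only [Real.norm_eq_abs, ENNReal.toReal_natCast, Real.rpow_natCast]
    refine ⟨by fun_prop, ?_⟩
    rw [hasFiniteIntegral_iff_ofReal hpow]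
    exact hlint.trans_lt ENNReal.ofReal_lt_top
  · rw [integral_eq_lintegral_of_nonneg_ae hpow (by fun_prop)]
    exact ENNReal.toReal_le_of_le_ofReal (by positivity) hlint

end Moments

end PointProcess

section UnitCell

variable {d : ℕ}

/-- The half-open unit cube `∏ₖ [iₖ, iₖ + 1)` of `ℝᵈ` with lower corner `i ∈ ℤᵈ`. -/
def unitCell (i : Fin d → ℤ) : Set (Space d) := {x | ∀ k, ⌊x k⌋ = i k}

/-- `D` can be covered by at most `N` unit cells. The bound `N` is real, so that it can be a
multiple of a volume. -/
def IsCoveredByCells (N : ℝ) (D : Set (Space d)) : Prop :=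
  ∃ I : Finset (Fin d → ℤ), D ⊆ ⋃ i ∈ I, unitCell i ∧ (I.card : ℝ) ≤ N

lemma unitCell_eq_preimage_pi (i : Fin d → ℤ) :
    unitCell i = (@WithLp.ofLp 2 (Fin d → ℝ)) ⁻¹' univ.pi fun k => Ico (i k : ℝ) (i k + 1) := by
  ext x
  simp [unitCell, Int.floor_eq_iff]

lemma measurableSet_unitCell (i : Fin d → ℤ) : MeasurableSet (unitCell i) := by
  rw [unitCell_eq_preimage_pi]
  exact (WithLp.measurable_ofLp 2 _) (MeasurableSet.univ_pi fun k => measurableSet_Ico)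

lemma volume_unitCell (i : Fin d → ℤ) : volume (unitCell i) = 1 := by
  rw [unitCell_eq_preimage_pi, (PiLp.volume_preserving_ofLp (Fin d)).measure_preimage
    (MeasurableSet.univ_pi fun k => measurableSet_Ico).nullMeasurableSet, volume_pi_pi]
  simp

lemma norm_sub_one_le_dist {i j : Fin d → ℤ} {x y : Space d} (hx : x ∈ unitCell i)
    (hy : y ∈ unitCell j) : ‖i - j‖ - 1 ≤ dist x y := by
  rw [sub_le_iff_le_add, pi_norm_le_iff_of_nonneg (by positivity)]
  intro k
  have hxy : |x k - y k| ≤ dist x y := by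
    rw [dist_eq_norm]
    exact PiLp.norm_apply_le (x - y) k
  rw [Pi.sub_apply, Int.norm_eq_abs]
  push_cast
  rw [← hx k, ← hy k]
  rw [abs_le] at hxy ⊢
  constructor <;>
    linarith [hxy.1, hxy.2, Int.floor_le (x k), Int.lt_floor_add_one (x k), Int.floor_le (y k),
      Int.lt_floor_add_one (y k)]

lemma summable_norm_rpow_int {κ : ℝ} (hκ : (d : ℝ) < κ) :
    Summable fun k : Fin d → ℤ => ‖k‖ ^ (-κ) := by
  let L : Submodule ℤ (Fin d → ℝ) := Submodule.span ℤ (range (Pi.basisFun ℝ (Fin d)))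
  have hrank : Module.finrank ℤ L = d := by
    rw [ZLattice.rank ℝ L]
    simp
  have hmem : ∀ k : Fin d → ℤ, (fun i => (k i : ℝ)) ∈ L := fun k => by
    have hk : (fun i => (k i : ℝ)) = ∑ i, k i • Pi.basisFun ℝ (Fin d) i := by
      ext j
      simp [Pi.single_apply]
    rw [hk]
    exact Submodule.sum_mem _ fun i _ => Submodule.smul_mem _ _ (Submodule.subset_span ⟨i, rfl⟩)
  have hinj : Function.Injective fun k : Fin d → ℤ => (⟨fun i => (k i : ℝ), hmem k⟩ : L) :=
    fun k l h => by
      ext i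
      simpa using congrFun (congrArg Subtype.val h) i
  have hL := ZLattice.summable_norm_rpow L (-κ) (by rw [hrank]; linarith)
  refine (hL.comp_injective hinj).congr fun k => ?_
  simp only [Function.comp_apply]
  congr 1

lemma summable_one_add_norm_rpow_int {κ : ℝ} (hκ : (d : ℝ) < κ) :
    Summable fun k : Fin d → ℤ => (1 + ‖k‖) ^ (-κ) := by
  have hκ0 : 0 ≤ κ := (Nat.cast_nonneg d).trans hκ.le
  refine Summable.of_norm_bounded_eventually (summable_norm_rpow_int hκ) ?_
  filter_upwards [(finite_singleton (0 : Fin d → ℤ)).compl_mem_cofinite] with k hk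
  rw [Real.norm_of_nonneg (by positivity)]
  exact Real.rpow_le_rpow_of_nonpos (norm_pos_iff.2 hk) (by linarith) (neg_nonpos.2 hκ0)

end UnitCell

section Mixing

variable {Ω : Type*} [MeasurableSpace Ω] {μ : Measure Ω}

lemma abs_measureReal_inter_sub_le_one [IsProbabilityMeasure μ] (A B : Set Ω) :
    |μ.real (A ∩ B) - μ.real A * μ.real B| ≤ 1 :=
  abs_sub_le_of_nonneg_of_le measureReal_nonneg measureReal_le_one (by positivity)
    (mul_le_one₀ measureReal_le_one measureReal_nonneg measureReal_le_one)

namespace PointProcess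

variable {d : ℕ} {X : PointProcess Ω d} {k l k' l' : ℕ∞} {q : ℝ}

lemma mixingCoeff_nonneg : 0 ≤ X.mixingCoeff μ k l q := by
  refine Real.sSup_nonneg ?_
  rintro _ ⟨_, _, A, B, -, -, -, -, -, -, -, rfl⟩
  exact abs_nonneg _

variable [IsProbabilityMeasure μ]

lemma mixingCoeff_le_one : X.mixingCoeff μ k l q ≤ 1 := by
  refine Real.sSup_le ?_ zero_le_one
  rintro _ ⟨_, _, A, B, -, -, -, -, -, -, -, rfl⟩
  exact abs_measureReal_inter_sub_le_one A B

lemma le_mixingCoeff {Λ₁ Λ₂ : Set (Space d)} {A B : Set Ω} (h₁ : MeasurableSet Λ₁)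
    (h₂ : MeasurableSet Λ₂) (v₁ : volume Λ₁ ≤ (k : ℝ≥0∞)) (v₂ : volume Λ₂ ≤ (l : ℝ≥0∞))
    (hq : ∀ x ∈ Λ₁, ∀ y ∈ Λ₂, q ≤ dist x y) (hA : MeasurableSet[X.sigmaAlgebra Λ₁] A)
    (hB : MeasurableSet[X.sigmaAlgebra Λ₂] B) :
    |μ.real (A ∩ B) - μ.real A * μ.real B| ≤ X.mixingCoeff μ k l q := by
  refine le_csSup ⟨1, ?_⟩ ⟨Λ₁, Λ₂, A, B, h₁, h₂, v₁, v₂, hq, hA, hB, rfl⟩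
  rintro _ ⟨_, _, A, B, -, -, -, -, -, -, -, rfl⟩
  exact abs_measureReal_inter_sub_le_one A B

lemma mixingCoeff_mono (hk : k ≤ k') (hl : l ≤ l') :
    X.mixingCoeff μ k l q ≤ X.mixingCoeff μ k' l' q := by
  refine Real.sSup_le ?_ mixingCoeff_nonneg
  rintro _ ⟨Λ₁, Λ₂, A, B, h₁, h₂, v₁, v₂, hq, hA, hB, rfl⟩
  exact le_mixingCoeff h₁ h₂ (v₁.trans (mod_cast hk)) (v₂.trans (mod_cast hl)) hq hA hB

-- The shift by `2` turns the distance of two cells into `1 + ‖i - j‖`, which never vanishes.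
lemma exists_mixingCoeff_sub_two_le {τ : ℝ} (hτ : 0 ≤ τ)
    (h : (fun q : ℝ => X.mixingCoeff μ k l q) =O[atTop] fun q : ℝ => q ^ (-τ)) :
    ∃ A, 0 ≤ A ∧ ∀ q, 1 ≤ q → X.mixingCoeff μ k l (q - 2) ≤ A * q ^ (-τ) := by
  have hshift : (fun q : ℝ => q - 2) =Θ[atTop] fun q : ℝ => q :=
    (Asymptotics.IsEquivalent.refl.sub_isLittleO
      (Asymptotics.isLittleO_const_id_atTop 2)).isTheta
  have hpow : (fun q : ℝ => (q - 2) ^ (-τ)) =O[atTop] fun q : ℝ => q ^ (-τ) :=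
    (hshift.rpow ((eventually_ge_atTop 2).mono fun q hq => sub_nonneg.2 hq)
      (eventually_ge_atTop 0)).1
  obtain ⟨A, hA0, hA⟩ :=
    ((h.comp_tendsto (tendsto_atTop_add_const_right _ (-2) tendsto_id)).trans hpow).exists_nonneg
  obtain ⟨q₀, hq₀⟩ := eventually_atTop.1 hA.bound
  refine ⟨A + |q₀| ^ τ, by positivity, fun q hq => ?_⟩
  rw [add_mul]
  rcases le_total q₀ q with hlarge | hsmall
  · have hq' := hq₀ q hlarge
    rw [Function.comp_apply, Real.norm_of_nonneg mixingCoeff_nonneg,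
      Real.norm_of_nonneg (by positivity)] at hq'
    exact hq'.trans (le_add_of_nonneg_right (by positivity))
  · calc X.mixingCoeff μ k l (q - 2) ≤ 1 := mixingCoeff_le_one
      _ = q ^ τ * q ^ (-τ) := by rw [← Real.rpow_add (by linarith), add_neg_cancel, Real.rpow_zero]
      _ ≤ |q₀| ^ τ * q ^ (-τ) := by
          gcongr
          exact hsmall.trans (le_abs_self _)
      _ ≤ A * q ^ (-τ) + |q₀| ^ τ * q ^ (-τ) := le_add_of_nonneg_left (by positivity)

end PointProcess

end Mixing

section Variance

lemma variance_sub_le_two_mul {Ω : Type*} [MeasurableSpace Ω] {μ : Measure Ω}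
    [IsProbabilityMeasure μ] {X Y : Ω → ℝ} (hX : MemLp X 2 μ) (hY : MemLp Y 2 μ) :
    ProbabilityTheory.variance (fun ω => X ω - Y ω) μ ≤
      2 * (ProbabilityTheory.variance X μ + ProbabilityTheory.variance Y μ) := by
  have hsub := ProbabilityTheory.variance_fun_sub hX hY
  have hadd := ProbabilityTheory.variance_fun_add hX hY
  linarith [ProbabilityTheory.variance_nonneg (fun ω => X ω + Y ω) μ]

lemma mul_rpow_sq_add_div_rpow_pow {τ q A C : ℝ} (hq : 0 < q) (t : ℕ) :
    A * q ^ (-τ) * (q ^ (τ / (2 + t))) ^ 2 + 2 * C / (q ^ (τ / (2 + t))) ^ t =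
      (A + 2 * C) * q ^ (-(τ * t / (2 + t))) := by
  have hsq : (q ^ (τ / (2 + t))) ^ 2 = q ^ (τ / (2 + t) * 2) := by
    rw [Real.rpow_mul hq.le]
    norm_cast
  have hpow : (q ^ (τ / (2 + t))) ^ t = q ^ (τ * t / (2 + t)) := by
    rw [mul_div_right_comm, Real.rpow_mul hq.le]
    norm_cast
  have hexp : -τ + τ / (2 + t) * 2 = -(τ * t / (2 + t)) := by
    field_simp
    ring
  rw [hsq, hpow, mul_assoc, ← Real.rpow_add hq, hexp, Real.rpow_neg hq.le,
    div_eq_mul_inv (2 * C), add_mul]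

namespace PointProcess

variable {Ω : Type*} [MeasurableSpace Ω] {μ : Measure Ω} [IsProbabilityMeasure μ] {d t : ℕ}
  {X : PointProcess Ω d} {ρr : (Fin (2 + t) → Space d) → ℝ} {M K : ℝ} {D : Set (Space d)}
  {f : Space d → ℝ}

lemma HasProductDensity.memLp_linStat_inter_unitCell (hρ : X.HasProductDensity μ (2 + t) ρr)
    (hM : ∀ v, ρr v ≤ M) (hD : Bornology.IsBounded D) (hDm : MeasurableSet D)
    (hfm : Measurable f) (hf0 : ∀ u, 0 ≤ f u) (hfK : ∀ u, f u ≤ K) (i : Fin d → ℤ) :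
    MemLp (X.linStat (D ∩ unitCell i) f) ((2 + t : ℕ) : ℝ≥0∞) μ ∧
      ∫ ω, X.linStat (D ∩ unitCell i) f ω ^ (2 + t) ∂μ ≤
        K ^ (2 + t) * ((2 * (2 + t : ℕ)) ^ (2 + t) + 2 ^ (2 + t) * M) := by
  simpa only [abs_of_nonneg (X.linStat_nonneg _ hf0 _)] using
    hρ.memLp_linStat_and_integral_le (by omega) hM (hD.subset inter_subset_left)
      (hDm.inter (measurableSet_unitCell i))
      ((measure_mono inter_subset_right).trans_eq (volume_unitCell i)) hfm
      (fun u => (abs_of_nonneg (hf0 u)).trans_le (hfK u))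

lemma HasProductDensity.abs_covariance_linStat_le (hρ : X.HasProductDensity μ (2 + t) ρr)
    (hM : ∀ v, ρr v ≤ M) {A τ : ℝ}
    (hA : ∀ q, 1 ≤ q → X.mixingCoeff μ 1 1 (q - 2) ≤ A * q ^ (-τ))
    (hD : Bornology.IsBounded D) (hDm : MeasurableSet D) (hfm : Measurable f)
    (hf0 : ∀ u, 0 ≤ f u) (hfK : ∀ u, f u ≤ K) (i j : Fin d → ℤ) :
    |ProbabilityTheory.covariance (X.linStat (D ∩ unitCell i) f)
        (X.linStat (D ∩ unitCell j) f) μ| ≤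
      (A + 2 * (K ^ (2 + t) * ((2 * (2 + t : ℕ)) ^ (2 + t) + 2 ^ (2 + t) * M))) *
        (1 + ‖i - j‖) ^ (-(τ * t / (2 + t))) := by
  have hb : ∀ i, Bornology.IsBounded (D ∩ unitCell i) := fun i => hD.subset inter_subset_left
  have hm : ∀ i, MeasurableSet (D ∩ unitCell i) := fun i => hDm.inter (measurableSet_unitCell i)
  have hv : ∀ i, volume (D ∩ unitCell i) ≤ ((1 : ℕ∞) : ℝ≥0∞) := fun i => by
    simpa using (measure_mono inter_subset_right).trans_eq (volume_unitCell i)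
  have hmom := hρ.memLp_linStat_inter_unitCell hM hD hDm hfm hf0 hfK
  have hq : 1 ≤ 1 + ‖i - j‖ := le_add_of_nonneg_right (norm_nonneg _)
  rw [← mul_rpow_sq_add_div_rpow_pow (by positivity)]
  refine abs_covariance_le_of_mixing (X.measurable_linStat (hb i) (hm i) hfm)
    (X.measurable_linStat (hb j) (hm j) hfm) (X.linStat_nonneg _ hf0) (X.linStat_nonneg _ hf0)
    (hmom i).1 (hmom j).1 (hmom i).2 (hmom j).2 (fun a b => ?_) (by positivity)
  refine (le_mixingCoeff (hm i) (hm j) (hv i) (hv j) (fun x hx y hy => ?_)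
    (X.measurable_linStat_sigmaAlgebra (hb i) (hm i) hfm measurableSet_Ioi)
    (X.measurable_linStat_sigmaAlgebra (hb j) (hm j) hfm measurableSet_Ioi)).trans (hA _ hq)
  linarith [norm_sub_one_le_dist hx.2 hy.2]

lemma linStat_eq_sum_unitCell (hD : Bornology.IsBounded D) {I : Finset (Fin d → ℤ)}
    (hI : D ⊆ ⋃ i ∈ I, unitCell i) (f : Space d → ℝ) :
    X.linStat D f = fun ω => ∑ i ∈ I, X.linStat (D ∩ unitCell i) f ω := by
  ext ω
  have hdisj : (I : Set (Fin d → ℤ)).PairwiseDisjoint fun i => X.pts ω ∩ (D ∩ unitCell i) :=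
    fun i _ j _ hij => disjoint_left.2 fun x hi hj => hij <| funext fun k =>
      (hi.2.2 k).symm.trans (hj.2.2 k)
  have hunion : X.pts ω ∩ D = ⋃ i ∈ (I : Set (Fin d → ℤ)), X.pts ω ∩ (D ∩ unitCell i) := by
    simp only [← inter_iUnion, Finset.mem_coe]
    rw [inter_eq_left.2 hI]
  simp only [linStat]
  rw [hunion, finsum_mem_biUnion hdisj I.finite_toSet
    fun i _ => X.finite_inter (hD.subset inter_subset_left) ω, finsum_mem_coe_finset]

lemma variance_linStat_le_tsum_mul {c : (Fin d → ℤ) → ℝ} (hc : Summable c) (hc0 : ∀ k, 0 ≤ c k)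
    (hD : Bornology.IsBounded D) {N : ℝ} (hN : IsCoveredByCells N D)
    (hL : ∀ i, MemLp (X.linStat (D ∩ unitCell i) f) 2 μ)
    (hcov : ∀ i j, |ProbabilityTheory.covariance (X.linStat (D ∩ unitCell i) f)
      (X.linStat (D ∩ unitCell j) f) μ| ≤ c (i - j)) :
    MemLp (X.linStat D f) 2 μ ∧
      ProbabilityTheory.variance (X.linStat D f) μ ≤ (∑' k, c k) * N := by
  obtain ⟨I, hI, hcard⟩ := hN
  have hL' : MemLp (X.linStat D f) 2 μ := by
    rw [linStat_eq_sum_unitCell hD hI]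
    exact memLp_finsetSum _ fun i _ => hL i
  refine ⟨hL', ?_⟩
  rw [← ProbabilityTheory.covariance_self hL'.aestronglyMeasurable.aemeasurable,
    linStat_eq_sum_unitCell hD hI,
    ProbabilityTheory.covariance_fun_sum_fun_sum' (fun i _ => hL i) fun i _ => hL i]
  calc _ ≤ ∑ i ∈ I, ∑ j ∈ I, c (i - j) :=
        Finset.sum_le_sum fun i _ => Finset.sum_le_sum fun j _ => (le_abs_self _).trans (hcov i j)
    _ ≤ ∑ _ ∈ I, ∑' k, c k := Finset.sum_le_sum fun i _ => by
        have hi : Summable fun j => c (i - j) := (Equiv.subLeft i).summable_iff.2 hc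
        exact (hi.sum_le_tsum I fun j _ => hc0 _).trans_eq ((Equiv.subLeft i).tsum_eq c)
    _ = (∑' k, c k) * I.card := by rw [Finset.sum_const, nsmul_eq_mul, mul_comm]
    _ ≤ _ := mul_le_mul_of_nonneg_left hcard (tsum_nonneg hc0)

lemma HasProductDensity.exists_variance_linStat_le_of_nonneg
    (hρ : X.HasProductDensity μ (2 + t) ρr) (ht : t ≠ 0) (hM : ∀ v, ρr v ≤ M) {τ : ℝ}
    (hτ : (d : ℝ) * (2 + t) / t < τ)
    (hmix : (fun q : ℝ => X.mixingCoeff μ 1 1 q) =O[atTop] fun q : ℝ => q ^ (-τ)) (K : ℝ) :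
    ∃ C, ∀ (D : Set (Space d)) (N : ℝ) (f : Space d → ℝ), Bornology.IsBounded D →
      MeasurableSet D → IsCoveredByCells N D → Measurable f → (∀ u, 0 ≤ f u) → (∀ u, f u ≤ K) →
      MemLp (X.linStat D f) 2 μ ∧ ProbabilityTheory.variance (X.linStat D f) μ ≤ C * N := by
  have ht0 : (0 : ℝ) < t := by positivity
  obtain ⟨A, -, hA⟩ := exists_mixingCoeff_sub_two_le (le_trans (by positivity) hτ.le) hmix
  have hκ : (d : ℝ) < τ * t / (2 + t) := by
    rw [lt_div_iff₀ (by positivity)]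
    rwa [div_lt_iff₀ ht0] at hτ
  set C := A + 2 * (K ^ (2 + t) * ((2 * (2 + t : ℕ)) ^ (2 + t) + 2 ^ (2 + t) * M))
  refine ⟨∑' k : Fin d → ℤ, |C| * (1 + ‖k‖) ^ (-(τ * t / (2 + t))),
    fun D N f hD hDm hN hfm hf0 hfK => variance_linStat_le_tsum_mul
      ((summable_one_add_norm_rpow_int hκ).mul_left _) (fun k => by positivity) hD hN
      (fun i => ?_) fun i j => ?_⟩
  · exact (hρ.memLp_linStat_inter_unitCell hM hD hDm hfm hf0 hfK i).1.mono_exponent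
      (by exact_mod_cast Nat.le_add_right 2 t)
  · refine (hρ.abs_covariance_linStat_le hM hA hD hDm hfm hf0 hfK i j).trans ?_
    gcongr
    exact le_abs_self _

lemma HasProductDensity.exists_variance_linStat_le
    (hρ : X.HasProductDensity μ (2 + t) ρr) (ht : t ≠ 0) (hM : ∀ v, ρr v ≤ M) {τ : ℝ}
    (hτ : (d : ℝ) * (2 + t) / t < τ)
    (hmix : (fun q : ℝ => X.mixingCoeff μ 1 1 q) =O[atTop] fun q : ℝ => q ^ (-τ)) (K : ℝ) :
    ∃ C, ∀ (D : Set (Space d)) (N : ℝ) (f : Space d → ℝ), Bornology.IsBounded D →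
      MeasurableSet D → IsCoveredByCells N D → Measurable f → (∀ u, |f u| ≤ K) →
      MemLp (X.linStat D f) 2 μ ∧ ProbabilityTheory.variance (X.linStat D f) μ ≤ C * N := by
  obtain ⟨C, hC⟩ := hρ.exists_variance_linStat_le_of_nonneg ht hM hτ hmix K
  refine ⟨4 * C, fun D N f hD hDm hN hfm hfK => ?_⟩
  have hK0 : 0 ≤ K := (abs_nonneg _).trans (hfK 0)
  obtain ⟨hpos, vpos⟩ := hC D N (fun u => max (f u) 0) hD hDm hN (by fun_prop)
    (fun u => le_max_right _ _) fun u => max_le ((le_abs_self _).trans (hfK u)) hK0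
  obtain ⟨hneg, vneg⟩ := hC D N (fun u => max (-f u) 0) hD hDm hN (by fun_prop)
    (fun u => le_max_right _ _) fun u => max_le ((neg_le_abs _).trans (hfK u)) hK0
  rw [X.linStat_eq_sub hD]
  refine ⟨hpos.sub hneg, ?_⟩
  linarith [variance_sub_le_two_mul hpos hneg]

end PointProcess

end Variance

section Window

variable {d : ℕ} {E : Set (Space d)}

lemma windowVol_eq (E : Set (Space d)) (n : ℕ) : windowVol E n = n ^ d * volume.real E := by
  rw [windowVol, window, measureReal_def, Measure.addHaar_smul, ENNReal.toReal_mul,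
    ENNReal.toReal_ofReal (abs_nonneg _), measureReal_def, abs_of_nonneg (by positivity)]
  simp

lemma isCoveredByCells_of_norm_le {D : Set (Space d)} {R : ℕ} (hD : ∀ x ∈ D, ‖x‖ ≤ R) :
    IsCoveredByCells ((2 * R + 1 : ℕ) ^ d) D := by
  refine ⟨Fintype.piFinset fun _ => Finset.Icc (-R : ℤ) R, fun x hx => ?_, ?_⟩
  · have hfloor : ∀ k, ⌊x k⌋ ∈ Finset.Icc (-R : ℤ) R := fun k => by
      have hk := abs_le.1 ((PiLp.norm_apply_le x k).trans (hD x hx))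
      rw [Finset.mem_Icc, Int.le_floor]
      exact ⟨by exact_mod_cast hk.1, by exact_mod_cast (Int.floor_le _).trans hk.2⟩
    exact mem_biUnion (Finset.mem_coe.2 (Fintype.mem_piFinset.2 hfloor)) fun k => rfl
  · rw [Fintype.card_piFinset_const, Int.card_Icc]
    have : (R + 1 - -R : ℤ).toNat = 2 * R + 1 := by omega
    rw [this]
    push_cast
    rfl

lemma exists_isCoveredByCells_window (hE : IsCompact E) (hint : (interior E).Nonempty) :
    ∃ C, ∀ᶠ n in atTop, IsCoveredByCells (C * windowVol E n) (window E n) := by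
  have hvol : 0 < volume.real E :=
    ENNReal.toReal_pos (Measure.measure_pos_of_nonempty_interior _ hint).ne' hE.measure_ne_top
  obtain ⟨R', hR'⟩ := hE.isBounded.exists_norm_le
  obtain ⟨R, hR⟩ := exists_nat_ge R'
  refine ⟨(2 * R + 1) ^ d / volume.real E, (eventually_ne_atTop 0).mono fun n hn => ?_⟩
  have hnorm : ∀ x ∈ window E n, ‖x‖ ≤ (n * R : ℕ) := by
    rintro _ ⟨e, he, rfl⟩
    simp only [norm_smul, RCLike.norm_natCast, Nat.cast_mul]
    gcongr
    exact (hR' e he).trans hR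
  obtain ⟨I, hI, hcard⟩ := isCoveredByCells_of_norm_le hnorm
  refine ⟨I, hI, hcard.trans ?_⟩
  have hn1 : (1 : ℝ) ≤ n := by exact_mod_cast Nat.one_le_iff_ne_zero.2 hn
  calc ((2 * (n * R) + 1 : ℕ) : ℝ) ^ d ≤ ((2 * R + 1) * n) ^ d := by
        push_cast
        gcongr
        linarith
    _ = _ := by
        rw [windowVol_eq, mul_pow]
        field_simp

end Window

section Taylor

lemma one_add_add_sq_div_four_le_exp {x : ℝ} (hx : |x| ≤ 1) :
    1 + x + x ^ 2 / 4 ≤ Real.exp x := by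
  have h := Real.exp_bound hx (n := 3) (by norm_num)
  norm_num [Finset.sum_range_succ, Nat.factorial] at h
  have hcube : |x| ^ 3 ≤ x ^ 2 := by
    rw [pow_succ, sq_abs]
    exact mul_le_of_le_one_right (sq_nonneg x) hx
  nlinarith [(abs_le.1 h).1, sq_nonneg x]

lemma differentiableAt_iteratedDeriv_of_contDiffOn {F : Type*} [NormedAddCommGroup F]
    [NormedSpace ℝ F] {f : ℝ → F} {U : Set ℝ} (hU : IsOpen U) {n m : ℕ} (hf : ContDiffOn ℝ n f U)
    (hm : m < n) {x : ℝ} (hx : x ∈ U) : DifferentiableAt ℝ (iteratedDeriv m f) x := by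
  have h := (hf.differentiableOn_iteratedDerivWithin (m := m) (by exact_mod_cast hm)
    hU.uniqueDiffOn).differentiableAt (hU.mem_nhds hx)
  refine h.congr_of_eventuallyEq ?_
  filter_upwards [hU.mem_nhds hx] with y hy
  exact (iteratedDerivWithin_of_isOpen hU hy).symm

lemma norm_iteratedDeriv_le_add_mul {F : Type*} [NormedAddCommGroup F] [NormedSpace ℝ F]
    {f : ℝ → F} {m : ℕ} {x B R : ℝ}
    (hf : ∀ y ∈ Metric.closedBall x R, DifferentiableAt ℝ (iteratedDeriv m f) y)
    (hB : ∀ y ∈ Metric.closedBall x R, ‖iteratedDeriv (m + 1) f y‖ ≤ B) {y : ℝ}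
    (hy : y ∈ Metric.closedBall x R) :
    ‖iteratedDeriv m f y‖ ≤ ‖iteratedDeriv m f x‖ + B * R := by
  have hx : x ∈ Metric.closedBall x R :=
    Metric.mem_closedBall_self (dist_nonneg.trans (Metric.mem_closedBall.1 hy))
  have hmvt := (convex_closedBall x R).norm_image_sub_le_of_norm_deriv_le hf (C := B)
    (fun y hy => by rw [← iteratedDeriv_succ]; exact hB y hy) hx hy
  have hB0 : 0 ≤ B := (norm_nonneg _).trans (hB x hx)
  calc ‖iteratedDeriv m f y‖
      ≤ ‖iteratedDeriv m f x‖ + ‖iteratedDeriv m f y - iteratedDeriv m f x‖ :=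
        norm_le_norm_add_norm_sub' _ _
    _ ≤ ‖iteratedDeriv m f x‖ + B * R := by
        gcongr
        exact hmvt.trans (mul_le_mul_of_nonneg_left (mem_closedBall_iff_norm.1 hy) hB0)

lemma abs_add_sub_le_of_abs_iteratedDeriv_three_le {f : ℝ → ℝ} {x r M a c h : ℝ}
    (hf : ContDiffOn ℝ 3 f (Metric.ball x r))
    (hM : ∀ y ∈ Metric.ball x r, |iteratedDeriv 3 f y| ≤ M)
    (ha : |deriv f x| ≤ a) (hc : |iteratedDeriv 2 f x| ≤ c) (hh : |h| < r) :
    |f (x + h) - f x| ≤ a * |h| + (c + M * |h|) * h ^ 2 := by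
  have hsub : Metric.closedBall x |h| ⊆ Metric.ball x r := Metric.closedBall_subset_ball hh
  have hdiff : ∀ m : ℕ, m < 3 → ∀ y ∈ Metric.closedBall x |h|,
      DifferentiableAt ℝ (iteratedDeriv m f) y := fun m hm y hy =>
    differentiableAt_iteratedDeriv_of_contDiffOn Metric.isOpen_ball hf hm (hsub hy)
  have hsecond : ∀ y ∈ Metric.closedBall x |h|, ‖iteratedDeriv (1 + 1) f y‖ ≤ c + M * |h| :=
    fun y hy => (norm_iteratedDeriv_le_add_mul (hdiff 2 (by norm_num))
      (fun y hy => hM y (hsub hy)) hy).trans (by gcongr; exact hc)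
  have hfirst : ∀ y ∈ Metric.closedBall x |h|, ‖deriv f y‖ ≤ a + (c + M * |h|) * |h| := by
    intro y hy
    have hderiv := norm_iteratedDeriv_le_add_mul (hdiff 1 (by norm_num)) hsecond hy
    rw [iteratedDeriv_one] at hderiv
    exact hderiv.trans (by gcongr; exact ha)
  have hmvt := (convex_closedBall x |h|).norm_image_sub_le_of_norm_deriv_le
    (fun y hy => by simpa using hdiff 0 (by norm_num) y hy) hfirst
    (Metric.mem_closedBall_self (abs_nonneg h)) (show x + h ∈ Metric.closedBall x |h| by simp)
  rw [add_sub_cancel_left, Real.norm_eq_abs, Real.norm_eq_abs] at hmvt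
  refine hmvt.trans_eq ?_
  rw [← sq_abs h]
  ring

end Taylor

section MinEigenvalue

open scoped Matrix

lemma minEigenvalue_mul_dotProduct_self_le {p : ℕ} {A : Matrix (Fin p) (Fin p) ℝ}
    (hA : A.IsHermitian) (x : Fin p → ℝ) : minEigenvalue A * (x ⬝ᵥ x) ≤ x ⬝ᵥ A *ᵥ x := by
  have hbdd : BddBelow (spectrum ℝ A) := by
    rw [hA.spectrum_real_eq_range_eigenvalues]
    exact (finite_range _).bddBelow
  have hpos : (A - algebraMap ℝ (Matrix (Fin p) (Fin p) ℝ) (minEigenvalue A)).PosSemidef := by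
    rw [Matrix.posSemidef_iff_isHermitian_and_spectrum_nonneg]
    refine ⟨hA.sub ?_, fun y hy => ?_⟩
    · rw [Matrix.algebraMap_eq_diagonal]
      exact Matrix.isHermitian_diagonal _
    · rw [← spectrum.sub_singleton_eq] at hy
      obtain ⟨e, he, _, rfl, rfl⟩ := hy
      exact sub_nonneg.2 (csInf_le hbdd he)
  have h := (Matrix.posSemidef_iff_dotProduct_mulVec.1 hpos).2 x
  rw [Matrix.sub_mulVec, dotProduct_sub, Algebra.algebraMap_eq_smul_one, Matrix.smul_mulVec,
    Matrix.one_mulVec, dotProduct_smul, star_trivial, smul_eq_mul] at h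
  exact sub_nonneg.1 h

end MinEigenvalue

section Penalty

lemma lowerSemicontinuous_comp_abs {f : ℝ → ℝ} (hf : LowerSemicontinuousOn f (Ici 0)) :
    LowerSemicontinuous fun x => f |x| := by
  rw [← lowerSemicontinuousOn_univ_iff]
  exact hf.comp continuous_abs.continuousOn fun x _ => abs_nonneg x

lemma IsPenaltyFamily.lowerSemicontinuousOn {pen : ℝ → ℝ → ℝ} (hpen : IsPenaltyFamily pen)
    {l : ℝ} (hl : 0 ≤ l) : LowerSemicontinuousOn (pen l) (Ici 0) := by
  intro x hx
  rcases (mem_Ici.1 hx).eq_or_lt with rfl | hx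
  · intro y hy
    rw [hpen.zero l hl] at hy
    exact eventually_mem_nhdsWithin.mono fun θ hθ => hy.trans_le (hpen.nonneg l hl θ hθ)
  · exact ((hpen.contDiffOn l hl).continuousOn.continuousAt
      (Ioi_mem_nhds hx)).lowerSemicontinuousAt.lowerSemicontinuousWithinAt _

lemma sum_ite_lt_le (p s : ℕ) {C : ℝ} (hC : 0 ≤ C) :
    ∑ j : Fin p, (if (j : ℕ) < s then C else 0) ≤ s * C := by
  rw [Fin.sum_univ_eq_sum_range fun j => if j < s then C else 0, ← Finset.sum_filter,
    Finset.sum_const, nsmul_eq_mul]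
  gcongr
  calc _ ≤ (Finset.range s).card := Finset.card_le_card fun j hj => by
        simpa using (Finset.mem_filter.1 hj).2
    _ = s := Finset.card_range s

variable {pen : ℝ → ℝ → ℝ} {lam : ℕ → ℝ} {s p : ℕ} {b : Fin s → ℝ} {R a κ : ℝ}

lemma pen_trueParam_sub_le (h0 : ∀ j, pen (lam j) 0 = 0)
    (hnonneg : ∀ j, ∀ θ, 0 ≤ θ → 0 ≤ pen (lam j) θ) (ha : 0 ≤ a) (hκ : 0 ≤ κ)
    (hloc : ∀ j : Fin s, ∀ h, |h| ≤ R →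
      |pen (lam j) (|b j| + h) - pen (lam j) (|b j|)| ≤ a * |h| + κ * h ^ 2)
    {δ : EuclideanSpace ℝ (Fin p)} (hδ : ‖δ‖ ≤ R) (j : Fin p) :
    pen (lam j) |trueParam b p j| - pen (lam j) |(trueParam b p + δ) j| ≤
      (if (j : ℕ) < s then a * ‖δ‖ else 0) + κ * δ j ^ 2 := by
  have hδj : |δ j| ≤ ‖δ‖ := PiLp.norm_apply_le δ j
  rw [PiLp.add_apply]
  by_cases hj : (j : ℕ) < s
  · have hb : trueParam b p j = b ⟨j, hj⟩ := by simp [trueParam, hj]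
    rw [if_pos hj, hb]
    set β := b ⟨j, hj⟩
    have hincr : |(|β + δ j| - |β|)| ≤ |δ j| := by
      simpa using abs_abs_sub_abs_le_abs_sub (β + δ j) β
    have hdiff := hloc ⟨j, hj⟩ (|β + δ j| - |β|) (hincr.trans (hδj.trans hδ))
    rw [add_sub_cancel, abs_sub_comm] at hdiff
    refine (le_abs_self _).trans (hdiff.trans ?_)
    gcongr ?_ * ?_ + ?_ * ?_
    · exact hincr.trans hδj
    · exact sq_le_sq.2 hincr
  · have hb : trueParam b p j = 0 := by simp [trueParam, hj]
    rw [if_neg hj, hb, abs_zero, h0]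
    have := hnonneg j _ (abs_nonneg (0 + δ j))
    have : 0 ≤ κ * δ j ^ 2 := by positivity
    linarith

lemma sum_pen_trueParam_sub_le (h0 : ∀ j, pen (lam j) 0 = 0)
    (hnonneg : ∀ j, ∀ θ, 0 ≤ θ → 0 ≤ pen (lam j) θ) (ha : 0 ≤ a) (hκ : 0 ≤ κ)
    (hloc : ∀ j : Fin s, ∀ h, |h| ≤ R →
      |pen (lam j) (|b j| + h) - pen (lam j) (|b j|)| ≤ a * |h| + κ * h ^ 2)
    {δ : EuclideanSpace ℝ (Fin p)} (hδ : ‖δ‖ ≤ R) :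
    ∑ j : Fin p, pen (lam j) |trueParam b p j| - ∑ j : Fin p, pen (lam j) |(trueParam b p + δ) j|
      ≤ s * a * ‖δ‖ + κ * ‖δ‖ ^ 2 := by
  rw [← Finset.sum_sub_distrib]
  refine (Finset.sum_le_sum fun j _ =>
    pen_trueParam_sub_le h0 hnonneg ha hκ hloc hδ j).trans ?_
  rw [Finset.sum_add_distrib, ← Finset.mul_sum, ← EuclideanSpace.real_norm_sq_eq, mul_assoc]
  gcongr
  exact sum_ite_lt_le p s (by positivity)

end Penalty

section LinearPredictor

variable {d p : ℕ}

/-- The linear predictor `z(u)ᵀ δ`, the logarithm of the intensity. -/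
noncomputable def linPred (z : ℕ → Space d → ℝ) (u : Space d)
    (δ : EuclideanSpace ℝ (Fin p)) : ℝ :=
  ∑ j : Fin p, z j u * δ j

/-- Covariates `z₀, …, z_{p-1}` bounded by `M` and a non-negative weight function `w` bounded by
`W`: the standing assumptions on the data of the model in finite dimension. -/
structure IsBoundedDesign (z : ℕ → Space d → ℝ) (w : Space d → ℝ) (p : ℕ) (M W : ℝ) : Prop where
  measurable_covariate : ∀ j < p, Measurable (z j)
  abs_covariate_le : ∀ j < p, ∀ u, |z j u| ≤ M
  bound_nonneg : 0 ≤ M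
  measurable_weight : Measurable w
  weight_nonneg : ∀ u, 0 ≤ w u
  weight_le : ∀ u, w u ≤ W

variable {z : ℕ → Space d → ℝ} {w : Space d → ℝ} {M W : ℝ}

lemma intensity_pos (β : EuclideanSpace ℝ (Fin p)) (u : Space d) : 0 < intensity z u β :=
  Real.exp_pos _

lemma intensity_add (β δ : EuclideanSpace ℝ (Fin p)) (u : Space d) :
    intensity z u (β + δ) = intensity z u β * Real.exp (linPred z u δ) := by
  simp only [intensity, linPred, ← Real.exp_add, ← Finset.sum_add_distrib, PiLp.add_apply, mul_add]

namespace IsBoundedDesign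

lemma measurable_linPred (h : IsBoundedDesign z w p M W) (δ : EuclideanSpace ℝ (Fin p)) :
    Measurable fun u => linPred z u δ :=
  Finset.measurable_fun_sum _ fun j _ => (h.measurable_covariate j j.2).mul_const _

lemma measurable_intensity (h : IsBoundedDesign z w p M W) (β : EuclideanSpace ℝ (Fin p)) :
    Measurable fun u => intensity z u β :=
  Real.measurable_exp.comp (h.measurable_linPred β)

lemma abs_linPred_le (h : IsBoundedDesign z w p M W) (δ : EuclideanSpace ℝ (Fin p))
    (u : Space d) : |linPred z u δ| ≤ M * √p * ‖δ‖ := by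
  have hM := h.bound_nonneg
  refine abs_le_of_sq_le_sq ((Finset.sum_mul_sq_le_sq_mul_sq _ _ _).trans ?_) (by positivity)
  rw [mul_pow, mul_pow, EuclideanSpace.real_norm_sq_eq, Real.sq_sqrt (by positivity)]
  gcongr
  calc ∑ j : Fin p, z j u ^ 2 ≤ ∑ _j : Fin p, M ^ 2 :=
        Finset.sum_le_sum fun j _ =>
          sq_le_sq' (abs_le.1 (h.abs_covariate_le j j.2 u)).1
            (abs_le.1 (h.abs_covariate_le j j.2 u)).2
    _ = M ^ 2 * p := by simp [mul_comm]

lemma intensity_le (h : IsBoundedDesign z w p M W) (β : EuclideanSpace ℝ (Fin p))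
    (u : Space d) : intensity z u β ≤ Real.exp (M * √p * ‖β‖) :=
  Real.exp_le_exp.2 ((le_abs_self _).trans (h.abs_linPred_le β u))

lemma abs_weight_le (h : IsBoundedDesign z w p M W) (u : Space d) : |w u| ≤ W := by
  rw [abs_of_nonneg (h.weight_nonneg u)]
  exact h.weight_le u

lemma abs_weight_mul_le (h : IsBoundedDesign z w p M W) {g : Space d → ℝ} {B : ℝ}
    (hg : ∀ u, |g u| ≤ B) (u : Space d) : |w u * g u| ≤ W * B := by
  rw [abs_mul]
  exact mul_le_mul (h.abs_weight_le u) (hg u) (abs_nonneg _)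
    ((abs_nonneg _).trans (h.abs_weight_le u))

lemma integrableOn_weight_mul_intensity (h : IsBoundedDesign z w p M W) {D : Set (Space d)}
    (hD : volume D ≠ ⊤) (β : EuclideanSpace ℝ (Fin p)) {g : Space d → ℝ} (hg : Measurable g)
    {B : ℝ} (hB : ∀ u, |g u| ≤ B) : IntegrableOn (fun u => w u * g u * intensity z u β) D := by
  refine Measure.integrableOn_of_bounded (M := W * B * Real.exp (M * √p * ‖β‖)) hD
    ((h.measurable_weight.mul hg).mul (h.measurable_intensity β)).aestronglyMeasurable
    (Eventually.of_forall fun u => ?_)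
  have hu := h.abs_weight_mul_le hB u
  rw [norm_mul, Real.norm_of_nonneg (intensity_pos β u).le]
  exact mul_le_mul hu (h.intensity_le β u) (intensity_pos β u).le ((abs_nonneg _).trans hu)

lemma continuous_integral_weight_mul_intensity (h : IsBoundedDesign z w p M W)
    {D : Set (Space d)} (hD : volume D ≠ ⊤) :
    Continuous fun β : EuclideanSpace ℝ (Fin p) => ∫ u in D, w u * intensity z u β := by
  rw [continuous_iff_continuousAt]
  intro β
  have : IsFiniteMeasure (volume.restrict D) := isFiniteMeasure_restrict.2 hD
  refine continuousAt_of_dominated (bound := fun _ => W * Real.exp (M * √p * (‖β‖ + 1)))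
    (Eventually.of_forall fun γ =>
      (h.measurable_weight.mul (h.measurable_intensity γ)).aestronglyMeasurable)
    ?_ (integrable_const _) (Eventually.of_forall fun u => by unfold intensity; fun_prop)
  filter_upwards [Metric.ball_mem_nhds β one_pos] with γ hγ
  refine Eventually.of_forall fun u => ?_
  have hM := h.bound_nonneg
  have hγ' : ‖γ‖ ≤ ‖β‖ + 1 := by
    linarith [norm_sub_norm_le γ β, mem_ball_iff_norm.1 hγ]
  rw [Real.norm_of_nonneg (mul_nonneg (h.weight_nonneg u) (intensity_pos γ u).le)]
  exact mul_le_mul (h.weight_le u) ((h.intensity_le γ u).trans (by gcongr))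
    (intensity_pos γ u).le ((h.weight_nonneg u).trans (h.weight_le u))

end IsBoundedDesign

end LinearPredictor

section Likelihood

open scoped Matrix

variable {Ω : Type*} [MeasurableSpace Ω] {d p : ℕ} {z : ℕ → Space d → ℝ} {w : Space d → ℝ}
  {M W : ℝ} {D : Set (Space d)}

/-- The vector `∑_{u ∈ X ∩ D} w(u) z(u)`, through which the likelihood depends on the points. -/
noncomputable def covariateSum (X : PointProcess Ω d) (z : ℕ → Space d → ℝ) (w : Space d → ℝ)
    (D : Set (Space d)) (p : ℕ) (ω : Ω) : EuclideanSpace ℝ (Fin p) :=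
  WithLp.toLp 2 fun j : Fin p => X.linStat D (fun u => w u * z j u) ω

/-- The vector `∫_D w(u) z(u) ρ(u; β) du`, the expectation of `covariateSum` at the parameter
`β`. -/
noncomputable def covariateMean (z : ℕ → Space d → ℝ) (w : Space d → ℝ)
    (D : Set (Space d)) (β : EuclideanSpace ℝ (Fin p)) : EuclideanSpace ℝ (Fin p) :=
  WithLp.toLp 2 fun j : Fin p => ∫ u in D, w u * z j u * intensity z u β

/-- The score, that is, the gradient at `β` of the weighted Poisson likelihood. -/
noncomputable def score (X : PointProcess Ω d) (z : ℕ → Space d → ℝ) (w : Space d → ℝ)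
    (D : Set (Space d)) (β : EuclideanSpace ℝ (Fin p)) (ω : Ω) : EuclideanSpace ℝ (Fin p) :=
  covariateSum X z w D p ω - covariateMean z w D β

lemma logLik_eq (X : PointProcess Ω d) (hD : Bornology.IsBounded D) (ω : Ω)
    (β : EuclideanSpace ℝ (Fin p)) :
    logLik z w D (X.pts ω) β =
      inner ℝ (covariateSum X z w D p ω) β - ∫ u in D, w u * intensity z u β := by
  rw [logLik, finsum_mem_eq_finite_toFinset_sum _ (X.finite_inter hD ω), PiLp.inner_apply]
  simp only [covariateSum, X.linStat_eq_sum hD, intensity, Real.log_exp, Finset.mul_sum,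
    RCLike.inner_apply, conj_trivial]
  rw [Finset.sum_comm]
  congr! 3
  ring

lemma IsBoundedDesign.measurable_covariateSum (h : IsBoundedDesign z w p M W)
    (X : PointProcess Ω d) (hD : Bornology.IsBounded D) (hDm : MeasurableSet D) :
    Measurable (covariateSum X z w D p) :=
  (WithLp.measurable_toLp 2 _).comp <| measurable_pi_lambda _ fun j =>
    X.measurable_linStat hD hDm (h.measurable_weight.mul (h.measurable_covariate j j.2))

lemma IsBoundedDesign.inner_covariateMean (h : IsBoundedDesign z w p M W) (hD : volume D ≠ ⊤)
    (β δ : EuclideanSpace ℝ (Fin p)) :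
    inner ℝ (covariateMean z w D β) δ =
      ∫ u in D, w u * linPred z u δ * intensity z u β := by
  have hint : ∀ j : Fin p, IntegrableOn (fun u => δ j * (w u * z j u * intensity z u β)) D :=
    fun j => (h.integrableOn_weight_mul_intensity hD β (h.measurable_covariate j j.2)
      (h.abs_covariate_le j j.2)).const_mul _
  calc inner ℝ (covariateMean z w D β) δ
      = ∑ j : Fin p, ∫ u in D, δ j * (w u * z j u * intensity z u β) := by
        simp only [PiLp.inner_apply, covariateMean, integral_const_mul, RCLike.inner_apply,
          conj_trivial]
    _ = ∫ u in D, w u * linPred z u δ * intensity z u β := by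
        rw [← integral_finsetSum _ fun j _ => hint j]
        simp only [linPred, Finset.mul_sum, Finset.sum_mul]
        congr! 3
        ring

lemma IsBoundedDesign.dotProduct_sensitivity_mulVec (h : IsBoundedDesign z w p M W)
    (hD : volume D ≠ ⊤) (β δ : EuclideanSpace ℝ (Fin p)) :
    δ.ofLp ⬝ᵥ sensitivity z w D β *ᵥ δ.ofLp =
      ∫ u in D, w u * linPred z u δ ^ 2 * intensity z u β := by
  have hint : ∀ i j : Fin p,
      IntegrableOn (fun u => δ i * (w u * (z i u * z j u) * intensity z u β * δ j)) D := fun i j =>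
    ((h.integrableOn_weight_mul_intensity hD β
      ((h.measurable_covariate i i.2).mul (h.measurable_covariate j j.2)) (B := M * M) fun u => by
        rw [Pi.mul_apply, abs_mul]
        exact mul_le_mul (h.abs_covariate_le i i.2 u) (h.abs_covariate_le j j.2 u)
          (abs_nonneg _) h.bound_nonneg).mul_const _).const_mul _
  calc δ.ofLp ⬝ᵥ sensitivity z w D β *ᵥ δ.ofLp
      = ∑ i : Fin p, ∑ j : Fin p,
          ∫ u in D, δ i * (w u * (z i u * z j u) * intensity z u β * δ j) := by
        simp only [dotProduct, Matrix.mulVec, sensitivity, Matrix.of_apply, Finset.mul_sum,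
          integral_const_mul, integral_mul_const]
    _ = ∫ u in D, w u * linPred z u δ ^ 2 * intensity z u β := by
        simp only [← integral_finsetSum _ fun j _ => hint _ j]
        rw [← integral_finsetSum _ fun i _ => integrable_finsetSum _ fun j _ => hint i j]
        congr! 2
        rw [linPred, sq, Finset.sum_mul_sum]
        simp only [Finset.mul_sum, Finset.sum_mul]
        exact Finset.sum_congr rfl fun i _ => Finset.sum_congr rfl fun j _ => by ring

lemma IsBoundedDesign.integral_weight_mul_intensity_add_ge (h : IsBoundedDesign z w p M W)
    (hD : volume D ≠ ⊤) (β : EuclideanSpace ℝ (Fin p)) {δ : EuclideanSpace ℝ (Fin p)}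
    (hδ : M * √p * ‖δ‖ ≤ 1) :
    (∫ u in D, w u * intensity z u β) + inner ℝ (covariateMean z w D β) δ +
        (δ.ofLp ⬝ᵥ sensitivity z w D β *ᵥ δ.ofLp) / 4 ≤
      ∫ u in D, w u * intensity z u (β + δ) := by
  have hlin : ∀ u, |linPred z u δ| ≤ 1 := fun u => (h.abs_linPred_le δ u).trans hδ
  have hint₀ : ∀ γ : EuclideanSpace ℝ (Fin p),
      IntegrableOn (fun u => w u * intensity z u γ) D := fun γ => by
    simpa using h.integrableOn_weight_mul_intensity hD γ measurable_const (g := fun _ => 1) (B := 1)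
      (by simp)
  have hint₁ := h.integrableOn_weight_mul_intensity hD β (h.measurable_linPred δ) hlin
  have hint₂ := h.integrableOn_weight_mul_intensity hD β ((h.measurable_linPred δ).pow_const 2)
    (B := 1) fun u => by rw [abs_pow]; exact pow_le_one₀ (abs_nonneg _) (hlin u)
  have hint₀₁ : IntegrableOn (fun u => w u * intensity z u β +
      w u * linPred z u δ * intensity z u β) D := (hint₀ β).add hint₁
  rw [h.inner_covariateMean hD, h.dotProduct_sensitivity_mulVec hD, ← integral_div,
    ← integral_add (hint₀ β) hint₁, ← integral_add hint₀₁ (hint₂.div_const 4)]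
  refine integral_mono (hint₀₁.add (hint₂.div_const 4)) (hint₀ (β + δ)) fun u => ?_
  have hwρ : 0 ≤ w u * intensity z u β := mul_nonneg (h.weight_nonneg u) (intensity_pos β u).le
  calc w u * intensity z u β + w u * linPred z u δ * intensity z u β +
        w u * linPred z u δ ^ 2 * intensity z u β / 4
      = w u * intensity z u β * (1 + linPred z u δ + linPred z u δ ^ 2 / 4) := by ring
    _ ≤ w u * intensity z u β * Real.exp (linPred z u δ) :=
        mul_le_mul_of_nonneg_left (one_add_add_sq_div_four_le_exp (hlin u)) hwρ
    _ = w u * intensity z u (β + δ) := by rw [intensity_add, mul_assoc]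

lemma IsBoundedDesign.logLik_add_le (h : IsBoundedDesign z w p M W) (X : PointProcess Ω d)
    (hD : Bornology.IsBounded D) (ω : Ω) (β : EuclideanSpace ℝ (Fin p))
    {δ : EuclideanSpace ℝ (Fin p)} (hδ : M * √p * ‖δ‖ ≤ 1) :
    logLik z w D (X.pts ω) (β + δ) ≤ logLik z w D (X.pts ω) β + inner ℝ (score X z w D β ω) δ -
      (δ.ofLp ⬝ᵥ sensitivity z w D β *ᵥ δ.ofLp) / 4 := by
  rw [logLik_eq X hD, logLik_eq X hD, score, inner_sub_left, inner_add_right]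
  linarith [h.integral_weight_mul_intensity_add_ge hD.measure_lt_top.ne β hδ]

lemma mul_norm_sq_le_dotProduct_sensitivity_mulVec {v ν : ℝ} (hv : 0 < v)
    (β δ : EuclideanSpace ℝ (Fin p)) (hν : ν ≤ minEigenvalue (v⁻¹ • sensitivity z w D β)) :
    ν * v * ‖δ‖ ^ 2 ≤ δ.ofLp ⬝ᵥ sensitivity z w D β *ᵥ δ.ofLp := by
  have hH : (sensitivity z w D β).IsHermitian := by
    ext i j
    simp only [sensitivity, Matrix.conjTranspose_apply, Matrix.of_apply, star_trivial, mul_comm]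
  have hnorm : δ.ofLp ⬝ᵥ δ.ofLp = ‖δ‖ ^ 2 := by
    rw [EuclideanSpace.real_norm_sq_eq]
    simp only [dotProduct, sq]
  have hmin := minEigenvalue_mul_dotProduct_self_le
    (hH.smul (IsSelfAdjoint.all v⁻¹)) δ.ofLp
  rw [Matrix.smul_mulVec, dotProduct_smul, smul_eq_mul, hnorm] at hmin
  calc ν * v * ‖δ‖ ^ 2 = v * (ν * ‖δ‖ ^ 2) := by ring
    _ ≤ v * (v⁻¹ * (δ.ofLp ⬝ᵥ sensitivity z w D β *ᵥ δ.ofLp)) :=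
        mul_le_mul_of_nonneg_left
          ((mul_le_mul_of_nonneg_right hν (sq_nonneg _)).trans hmin) hv.le
    _ = _ := mul_inv_cancel_left₀ hv.ne' _

variable {pen : ℝ → ℝ → ℝ} {lam : ℕ → ℝ}

lemma IsBoundedDesign.norm_le_of_penLogLik_le (h : IsBoundedDesign z w p M W)
    (X : PointProcess Ω d) (hD : Bornology.IsBounded D) (hv : 0 < volume.real D) {ν a : ℝ}
    {β δ : EuclideanSpace ℝ (Fin p)}
    (hν : ν ≤ minEigenvalue ((volume.real D)⁻¹ • sensitivity z w D β))
    (hδ : M * √p * ‖δ‖ ≤ 1) (ha : 0 ≤ a)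
    (hpen : ∑ j : Fin p, pen (lam j) |β j| - ∑ j : Fin p, pen (lam j) |(β + δ) j| ≤
      a * ‖δ‖ + ν / 8 * ‖δ‖ ^ 2) {ω : Ω}
    (hQ : penLogLik z w pen lam D (X.pts ω) β ≤ penLogLik z w pen lam D (X.pts ω) (β + δ)) :
    ν / 8 * volume.real D * ‖δ‖ ≤ ‖score X z w D β ω‖ + volume.real D * a := by
  rcases (norm_nonneg δ).eq_or_lt with h0 | h0
  · rw [← h0, mul_zero]
    positivity
  have hlik := h.logLik_add_le X hD ω β hδ
  have hquad := mul_norm_sq_le_dotProduct_sensitivity_mulVec hv β δ hν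
  have hcs := real_inner_le_norm (score X z w D β ω) δ
  have hpen' := mul_le_mul_of_nonneg_left hpen hv.le
  simp only [penLogLik] at hQ
  refine le_of_mul_le_mul_right ?_ h0
  linarith

lemma IsBoundedDesign.exists_measurable_isMaxOn_penLogLik (h : IsBoundedDesign z w p M W)
    (X : PointProcess Ω d) (hD : Bornology.IsBounded D) (hDm : MeasurableSet D)
    (hpen : ∀ j, LowerSemicontinuousOn (pen (lam j)) (Ici 0))
    {K : Set (EuclideanSpace ℝ (Fin p))} (hK : IsCompact K) (hne : K.Nonempty) :
    ∃ βhat : Ω → EuclideanSpace ℝ (Fin p), Measurable βhat ∧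
      ∀ ω, βhat ω ∈ K ∧ IsMaxOn (penLogLik z w pen lam D (X.pts ω)) K (βhat ω) := by
  have hpenalty : LowerSemicontinuous fun β : EuclideanSpace ℝ (Fin p) =>
      volume.real D * ∑ j : Fin p, pen (lam j) |β j| :=
    Continuous.comp_lowerSemicontinuous (g := fun x => volume.real D * x) (by fun_prop)
      (lowerSemicontinuous_sum fun j _ =>
        (lowerSemicontinuous_comp_abs (hpen j)).comp
          (g := fun β : EuclideanSpace ℝ (Fin p) => β j) (by fun_prop))
      fun x y hxy => mul_le_mul_of_nonneg_left hxy measureReal_nonneg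
  have hcont := h.continuous_integral_weight_mul_intensity hD.measure_lt_top.ne
  obtain ⟨φ, hφ, hmax⟩ := exists_measurable_isMaxOn hK hne
    (F := fun β τ : EuclideanSpace ℝ (Fin p) => inner ℝ τ β - (∫ u in D, w u * intensity z u β) +
      -(volume.real D * ∑ j : Fin p, pen (lam j) |β j|))
    (((continuous_snd.inner continuous_fst).sub
      (hcont.comp continuous_fst)).upperSemicontinuous.add
      (continuous_neg.comp_lowerSemicontinuous_antitone (hpenalty.comp continuous_fst)
        fun _ _ hxy => neg_le_neg hxy))
    fun β => by fun_prop
  refine ⟨fun ω => φ (covariateSum X z w D p ω),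
    hφ.comp (h.measurable_covariateSum X hD hDm), fun ω => ⟨(hmax _).1, ?_⟩⟩
  convert (hmax (covariateSum X z w D p ω)).2 using 2 with β
  rw [penLogLik, logLik_eq X hD, sub_eq_add_neg _ (volume.real D * _)]

end Likelihood

section Score

open ProbabilityTheory

variable {Ω : Type*} [MeasurableSpace Ω] {μ : Measure Ω} [IsProbabilityMeasure μ] {d : ℕ}
  {z : ℕ → Space d → ℝ} {w : Space d → ℝ} {M W : ℝ} {X : PointProcess Ω d}

lemma IsBoundedDesign.integral_norm_score_sq_le {p : ℕ} (h : IsBoundedDesign z w p M W)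
    {D : Set (Space d)} (hD : Bornology.IsBounded D) (hDm : MeasurableSet D)
    {β : EuclideanSpace ℝ (Fin p)} (hρ : X.HasIntensity μ fun u => intensity z u β) {B : ℝ}
    (hvar : ∀ j : Fin p, MemLp (X.linStat D fun u => w u * z j u) 2 μ ∧
      variance (X.linStat D fun u => w u * z j u) μ ≤ B) :
    Integrable (fun ω => ‖score X z w D β ω‖ ^ 2) μ ∧
      ∫ ω, ‖score X z w D β ω‖ ^ 2 ∂μ ≤ p * B := by
  have hcentred : ∀ (j : Fin p) ω, score X z w D β ω j =
      X.linStat D (fun u => w u * z j u) ω - ∫ ω, X.linStat D (fun u => w u * z j u) ω ∂μ :=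
    fun j ω => by
      rw [(hρ.integrable_linStat_and_integral_eq (f := fun u => w u * z j u) hD hDm
        (h.measurable_weight.mul (h.measurable_covariate j j.2))
        (h.integrableOn_weight_mul_intensity hD.measure_lt_top.ne β
          (h.measurable_covariate j j.2) (h.abs_covariate_le j j.2))).2]
      rfl
  have hint : ∀ j : Fin p, Integrable (fun ω => score X z w D β ω j ^ 2) μ := fun j => by
    simp only [hcentred]
    exact ((hvar j).1.sub (memLp_const _)).integrable_sq
  have hcomp : ∀ j : Fin p, ∫ ω, score X z w D β ω j ^ 2 ∂μ ≤ B := fun j => by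
    simp only [hcentred]
    rw [← variance_eq_integral (hvar j).1.aemeasurable]
    exact (hvar j).2
  simp only [EuclideanSpace.real_norm_sq_eq]
  refine ⟨integrable_finsetSum _ fun j _ => hint j, ?_⟩
  rw [integral_finsetSum _ fun j _ => hint j]
  exact (Finset.sum_le_card_nsmul _ _ _ fun j _ => hcomp j).trans_eq (by simp)

lemma isBigOP_norm_score {p : ℕ → ℕ} (h : ∀ n, IsBoundedDesign z w (p n) M W)
    {D : ℕ → Set (Space d)} (hD : ∀ n, Bornology.IsBounded (D n))
    (hDm : ∀ n, MeasurableSet (D n)) {C : ℝ}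
    (hcover : ∀ᶠ n in atTop, IsCoveredByCells (C * volume.real (D n)) (D n))
    (hpos : ∀ᶠ n in atTop, 0 < p n * volume.real (D n))
    {β : ∀ n, EuclideanSpace ℝ (Fin (p n))}
    (hρ : ∀ n, X.HasIntensity μ fun u => intensity z u (β n)) {t : ℕ} (ht : t ≠ 0)
    {ρr : (Fin (2 + t) → Space d) → ℝ} (hρr : X.HasProductDensity μ (2 + t) ρr) {M' : ℝ}
    (hM' : ∀ v, ρr v ≤ M') {τ : ℝ} (hτ : (d : ℝ) * (2 + t) / t < τ)
    (hmix : (fun q : ℝ => X.mixingCoeff μ 1 1 q) =O[atTop] fun q : ℝ => q ^ (-τ)) :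
    IsBigOP μ (fun n ω => ‖score X z w (D n) (β n) ω‖) fun n => √(p n * volume.real (D n)) := by
  obtain ⟨B, hB⟩ := hρr.exists_variance_linStat_le ht hM' hτ hmix (W * M)
  have hmoment : ∀ᶠ n in atTop, Integrable (fun ω => ‖score X z w (D n) (β n) ω‖ ^ 2) μ ∧
      ∫ ω, ‖score X z w (D n) (β n) ω‖ ^ 2 ∂μ ≤ p n * (B * (C * volume.real (D n))) :=
    hcover.mono fun n hn => (h n).integral_norm_score_sq_le (hD n) (hDm n) (hρ n) fun j =>
      hB (D n) _ _ (hD n) (hDm n) hn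
        ((h n).measurable_weight.mul ((h n).measurable_covariate j j.2))
        ((h n).abs_weight_mul_le ((h n).abs_covariate_le j j.2))
  refine .of_integral_sq_le (C := B * C) (hmoment.mono fun n hn => hn.1) ?_
    (hpos.mono fun n hn => (Real.sqrt_pos.2 hn).ne')
  filter_upwards [hmoment, hpos] with n hn hposn
  rw [Real.sq_sqrt hposn.le]
  exact hn.2.trans_eq (by ring)

end Score

section Localization

variable {Ω : Type*} [MeasurableSpace Ω] {d : ℕ} {z : ℕ → Space d → ℝ} {w : Space d → ℝ}
  {M W : ℝ} {pen : ℝ → ℝ → ℝ} {s : ℕ} {b : Fin s → ℝ}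

lemma IsBoundedDesign.norm_sub_trueParam_le {p : ℕ} (h : IsBoundedDesign z w p M W)
    (X : PointProcess Ω d) {D : Set (Space d)} (hD : Bornology.IsBounded D)
    (hv : 0 < volume.real D) {lam : ℕ → ℝ} (h0 : ∀ j, pen (lam j) 0 = 0)
    (hnonneg : ∀ j, ∀ θ, 0 ≤ θ → 0 ≤ pen (lam j) θ) {R a ν : ℝ} (ha : 0 ≤ a) (hν0 : 0 ≤ ν)
    (hν : ν ≤ minEigenvalue ((volume.real D)⁻¹ • sensitivity z w D (trueParam b p)))
    (hMR : M * √p * R ≤ 1)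
    (hloc : ∀ j : Fin s, ∀ x, |x| ≤ R →
      |pen (lam j) (|b j| + x) - pen (lam j) (|b j|)| ≤ a * |x| + ν / 8 * x ^ 2)
    {β : EuclideanSpace ℝ (Fin p)} (hβ : ‖β - trueParam b p‖ ≤ R) {ω : Ω}
    (hQ : penLogLik z w pen lam D (X.pts ω) (trueParam b p) ≤
      penLogLik z w pen lam D (X.pts ω) β) :
    ν / 8 * volume.real D * ‖β - trueParam b p‖ ≤
      ‖score X z w D (trueParam b p) ω‖ + volume.real D * (s * a) := by
  have hM := h.bound_nonneg
  refine h.norm_le_of_penLogLik_le (pen := pen) (lam := lam) X hD hv hν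
    (le_trans (by gcongr) hMR) (by positivity)
    (sum_pen_trueParam_sub_le h0 hnonneg ha (by positivity) hloc hβ) ?_
  rwa [add_sub_cancel]

lemma le_dist_of_isMaxOn_of_not_isLocalMax {V : Type*} [PseudoMetricSpace V] {f : V → ℝ}
    {x y : V} {R : ℝ} (hmax : IsMaxOn f (Metric.closedBall x R) y) (hloc : ¬ IsLocalMax f y) :
    R ≤ dist y x := by
  by_contra! hlt
  exact hloc (hmax.isLocalMax (Metric.closedBall_mem_nhds_of_mem hlt))

end Localization

section Rates

variable {pen : ℝ → ℝ → ℝ} {lam : ℕ → ℕ → ℝ} {s : ℕ} {b : Fin s → ℝ}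

lemma aSeq_nonneg (pen : ℝ → ℝ → ℝ) (lam : ℕ → ℕ → ℝ) (b : Fin s → ℝ) (n : ℕ) :
    0 ≤ aSeq pen lam b n := Real.iSup_nonneg fun _ => abs_nonneg _

lemma abs_deriv_le_aSeq (pen : ℝ → ℝ → ℝ) (lam : ℕ → ℕ → ℝ) (b : Fin s → ℝ) (n : ℕ)
    (j : Fin s) : |deriv (pen (lam n j)) (|b j|)| ≤ aSeq pen lam b n :=
  le_ciSup (f := fun j : Fin s => |deriv (pen (lam n j)) (|b j|)|) (finite_range _).bddAbove j

lemma abs_iteratedDeriv_two_le_cSeq (pen : ℝ → ℝ → ℝ) (lam : ℕ → ℕ → ℝ) (b : Fin s → ℝ)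
    (n : ℕ) (j : Fin s) : |iteratedDeriv 2 (pen (lam n j)) (|b j|)| ≤ cSeq pen lam b n :=
  le_ciSup (f := fun j : Fin s => |iteratedDeriv 2 (pen (lam n j)) (|b j|)|)
    (finite_range _).bddAbove j

lemma eventually_abs_pen_add_sub_le {r : ℕ → Fin s → ℝ} {e : ℕ → ℝ}
    (he : Tendsto e atTop (𝓝 0)) (he0 : ∀ᶠ n in atTop, 0 < e n)
    (hr : ∀ j, Tendsto (fun n => r n j * (e n)⁻¹) atTop atTop) {M : ℝ}
    (hsmooth : ∀ᶠ n in atTop, ∀ j : Fin s,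
      ContDiffOn ℝ 3 (pen (lam n j)) (Metric.ball |b j| (r n j)) ∧
      ∀ θ ∈ Metric.ball |b j| (r n j), |iteratedDeriv 3 (pen (lam n j)) θ| ≤ M)
    (hc : cSeq pen lam b =o[atTop] fun _ => (1 : ℝ)) {κ : ℝ} (hκ : 0 < κ) (K : ℝ) :
    ∀ᶠ n in atTop, ∀ j : Fin s, ∀ x, |x| ≤ K * e n →
      |pen (lam n j) (|b j| + x) - pen (lam n j) (|b j|)| ≤
        aSeq pen lam b n * |x| + κ * x ^ 2 := by
  have hcurv : ∀ᶠ n in atTop, cSeq pen lam b n + |M| * (K * e n) < κ := by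
    have := ((Asymptotics.isLittleO_one_iff ℝ).1 hc).add ((he.const_mul K).const_mul |M|)
    simp only [mul_zero, add_zero] at this
    exact this.eventually_lt_const hκ
  have hradius : ∀ᶠ n in atTop, ∀ j, K * e n < r n j := by
    refine eventually_all.2 fun j => ?_
    filter_upwards [(hr j).eventually_gt_atTop K, he0] with n hn hen
    rwa [← div_eq_mul_inv, lt_div_iff₀ hen] at hn
  filter_upwards [hsmooth, hcurv, hradius] with n hsn hcn hrn j x hx
  refine (abs_add_sub_le_of_abs_iteratedDeriv_three_le (hsn j).1 (hsn j).2
    (abs_deriv_le_aSeq pen lam b n j) (abs_iteratedDeriv_two_le_cSeq pen lam b n j)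
    (hx.trans_lt (hrn j))).trans ?_
  gcongr
  calc cSeq pen lam b n + M * |x| ≤ cSeq pen lam b n + |M| * (K * e n) := by
        gcongr
        exact le_abs_self M
    _ ≤ κ := hcn.le

lemma minEigenvalue_zero (p : ℕ) : minEigenvalue (0 : Matrix (Fin p) (Fin p) ℝ) = 0 := by
  rcases subsingleton_or_nontrivial (Matrix (Fin p) (Fin p) ℝ) with h | h
  · rw [minEigenvalue, spectrum.of_subsingleton, Real.sInf_empty]
  · rw [minEigenvalue, spectrum.zero_eq, csInf_singleton]

lemma exists_pos_eventually_lt_of_pos_liminf {f : ℕ → ℝ}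
    (hf : (0 : EReal) < liminf (fun n => (f n : EReal)) atTop) :
    ∃ ν > 0, ∀ᶠ n in atTop, ν < f n := by
  obtain ⟨ν, hν, hνf⟩ := EReal.lt_iff_exists_real_btwn.1 hf
  exact ⟨ν, by exact_mod_cast hν, (eventually_lt_of_lt_liminf hνf).mono fun n hn => by
    exact_mod_cast hn⟩

lemma tendsto_sqrt_mul_sqrt_div {p v : ℕ → ℝ} (hp : ∀ n, 0 ≤ p n)
    (h : Tendsto (fun n => p n ^ 2 / v n) atTop (𝓝 0)) :
    Tendsto (fun n => √(p n) * √(p n / v n)) atTop (𝓝 0) := by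
  simp only [← Real.sqrt_mul (hp _), ← mul_div_assoc, ← sq]
  simpa using h.sqrt

lemma tendsto_sq_div_of_tendsto_cube_div {p : ℕ → ℕ} {v : ℕ → ℝ} (hv : ∀ n, 0 ≤ v n)
    (h : Tendsto (fun n => (p n : ℝ) ^ 3 / v n) atTop (𝓝 0)) :
    Tendsto (fun n => (p n : ℝ) ^ 2 / v n) atTop (𝓝 0) := by
  refine squeeze_zero (fun n => div_nonneg (by positivity) (hv n)) (fun n => ?_) h
  refine div_le_div_of_nonneg_right ?_ (hv n)
  rcases (p n).eq_zero_or_pos with hpn | hpn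
  · simp [hpn]
  · exact pow_le_pow_right₀ (by exact_mod_cast hpn) (by norm_num)

lemma IsBigOP.of_mul_le_add {Ω : Type*} [MeasurableSpace Ω] {μ : Measure Ω}
    {Y S : ℕ → Ω → ℝ} {p v a : ℕ → ℝ} {c K : ℝ}
    (hS : IsBigOP μ S fun n => √(p n * v n)) (hp : ∀ᶠ n in atTop, 1 ≤ p n)
    (hv : ∀ᶠ n in atTop, 0 < v n) (ha : a =O[atTop] fun n => (√(v n))⁻¹) (hc : 0 < c)
    (hK : 0 ≤ K)
    (hY : ∀ᶠ n in atTop, ∀ ω, 0 ≤ Y n ω ∧ c * v n * Y n ω ≤ S n ω + v n * (K * a n)) :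
    IsBigOP μ Y fun n => √(p n / v n) := by
  obtain ⟨A, hA, ha⟩ := ha.exists_pos
  refine hS.of_forall_imp_le fun L hL => ⟨(L + K * A) / c, by positivity, ?_⟩
  filter_upwards [hp, hv, ha.bound, hY] with n hpn hvn han hYn ω hω
  obtain ⟨hY0, hYS⟩ := hYn ω
  have hrate : √(p n * v n) = v n * √(p n / v n) := by
    rw [show p n * v n = v n ^ 2 * (p n / v n) by field_simp, Real.sqrt_mul (sq_nonneg _),
      Real.sqrt_sq hvn.le]
  have hinv : (√(v n))⁻¹ ≤ √(p n / v n) := by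
    rw [← Real.sqrt_inv, inv_eq_one_div]
    gcongr
  have haA : a n ≤ A * √(p n / v n) := by
    rw [Real.norm_eq_abs, Real.norm_of_nonneg (by positivity)] at han
    exact (le_abs_self _).trans (han.trans (by gcongr))
  rw [abs_of_nonneg (Real.sqrt_nonneg _), hrate] at hω
  rw [abs_of_nonneg (Real.sqrt_nonneg _), abs_of_nonneg hY0, div_mul_eq_mul_div,
    le_div_iff₀ hc]
  refine le_of_mul_le_mul_left ?_ hvn
  calc v n * (Y n ω * c) = c * v n * Y n ω := by ring
    _ ≤ L * (v n * √(p n / v n)) + v n * (K * (A * √(p n / v n))) := by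
        refine hYS.trans (add_le_add ((le_abs_self _).trans hω) ?_)
        gcongr
    _ = v n * ((L + K * A) * √(p n / v n)) := by ring

end Rates

section SlowRadius

variable {pen : ℝ → ℝ → ℝ} {lam : ℕ → ℕ → ℝ} {s : ℕ} {b : Fin s → ℝ}

lemma pos_of_minEigenvalue_inv_smul_ne_zero {p : ℕ} {v : ℝ} (hv : 0 ≤ v)
    {A : Matrix (Fin p) (Fin p) ℝ} (h : minEigenvalue (v⁻¹ • A) ≠ 0) : 0 < p ∧ 0 < v := by
  have hA : v⁻¹ • A ≠ 0 := fun h0 => h (by rw [h0, minEigenvalue_zero])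
  refine ⟨Nat.pos_of_ne_zero ?_, hv.lt_of_ne' ?_⟩
  · rintro rfl
    exact hA (Subsingleton.elim _ _)
  · rintro rfl
    exact hA (by rw [inv_zero, zero_smul])

lemma exists_tendsto_atTop_eventually_abs_pen_add_sub_le {p : ℕ → ℕ} {v : ℕ → ℝ}
    (hpv : ∀ᶠ n in atTop, 0 < p n ∧ 0 < v n)
    (hrate : Tendsto (fun n => (p n : ℝ) ^ 2 / v n) atTop (𝓝 0)) {r : ℕ → Fin s → ℝ}
    (hr : ∀ j, Tendsto (fun n => r n j * √(v n / p n)) atTop atTop) {L : ℝ}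
    (hsmooth : ∀ᶠ n in atTop, ∀ j : Fin s,
      ContDiffOn ℝ 3 (pen (lam n j)) (Metric.ball |b j| (r n j)) ∧
      ∀ θ ∈ Metric.ball |b j| (r n j), |iteratedDeriv 3 (pen (lam n j)) θ| ≤ L)
    (hc : cSeq pen lam b =o[atTop] fun _ => (1 : ℝ)) {κ : ℝ} (hκ : 0 < κ) (M : ℝ) :
    ∃ k : ℕ → ℕ, Tendsto k atTop atTop ∧ ∀ᶠ n in atTop,
      M * √(p n) * (k n * √(p n / v n)) ≤ 1 ∧ ∀ j : Fin s, ∀ x, |x| ≤ k n * √(p n / v n) →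
        |pen (lam n j) (|b j| + x) - pen (lam n j) (|b j|)| ≤
          aSeq pen lam b n * |x| + κ * x ^ 2 := by
  have hpe := tendsto_sqrt_mul_sqrt_div (fun n => (p n).cast_nonneg) hrate
  have he : Tendsto (fun n => √(p n / v n)) atTop (𝓝 0) := by
    refine squeeze_zero' (.of_forall fun n => Real.sqrt_nonneg _) ?_ hpe
    filter_upwards [hpv] with n hn
    exact le_mul_of_one_le_left (Real.sqrt_nonneg _) (Real.one_le_sqrt.2 (by exact_mod_cast hn.1))
  have he0 : ∀ᶠ n in atTop, 0 < √(p n / v n) := hpv.mono fun n hn =>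
    Real.sqrt_pos.2 (div_pos (by exact_mod_cast hn.1) hn.2)
  have hr' : ∀ j, Tendsto (fun n => r n j * (√(p n / v n))⁻¹) atTop atTop := by
    simpa only [← Real.sqrt_inv, inv_div] using hr
  have hball : ∀ k : ℕ, ∀ᶠ n in atTop, M * √(p n) * (k * √(p n / v n)) ≤ 1 := fun k => by
    have hk := (hpe.const_mul (M * k)).eventually_le_const (by simp : M * k * 0 < 1)
    exact hk.mono fun n hn => (by ring : _ = _).trans_le hn
  exact exists_tendsto_atTop_eventually (P := fun k n => _ ∧ _) fun k =>
    (hball k).and (eventually_abs_pen_add_sub_le he he0 hr' hsmooth hc hκ k)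

end SlowRadius

section Consistency

variable {Ω : Type*} [MeasurableSpace Ω] {μ : Measure Ω} {V : ℕ → Type*}
  [∀ n, SeminormedAddCommGroup (V n)] {Y : ∀ n, Ω → V n} {y : ∀ n, V n} {e : ℕ → ℝ}

lemma IsBigOP.tendsto_measure_not_isLocalMax
    (hY : IsBigOP μ (fun n ω => ‖Y n ω - y n‖) e) (he : ∀ᶠ n in atTop, 0 < e n) {k : ℕ → ℕ}
    (hk : Tendsto k atTop atTop) {f : ∀ n, Ω → V n → ℝ}
    (hmax : ∀ n ω, IsMaxOn (f n ω) (Metric.closedBall (y n) (k n * e n)) (Y n ω)) :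
    Tendsto (fun n => μ {ω | ¬ IsLocalMax (f n ω) (Y n ω)}) atTop (𝓝 0) := by
  refine hY.tendsto_measure_zero fun L _ => ?_
  filter_upwards [(tendsto_natCast_atTop_atTop.comp hk).eventually_gt_atTop L, he]
    with n hkn hen ω hω
  rw [abs_of_pos hen, abs_norm, ← dist_eq_norm]
  exact (mul_lt_mul_of_pos_right hkn hen).trans_le
    (le_dist_of_isMaxOn_of_not_isLocalMax (hmax n ω) hω)

lemma IsBigOP.tendsto_measure_notMem
    (hY : IsBigOP μ (fun n ω => ‖Y n ω - y n‖) e) {Θ : ∀ n, Set (V n)}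
    (hΘ : ∀ K : ℝ, ∀ᶠ n in atTop, Metric.closedBall (y n) (K * e n) ⊆ Θ n)
    (he : ∀ᶠ n in atTop, 0 < e n) :
    Tendsto (fun n => μ {ω | Y n ω ∉ Θ n}) atTop (𝓝 0) := by
  refine hY.tendsto_measure_zero fun L _ => ?_
  filter_upwards [hΘ L, he] with n hn hen ω hω
  rw [abs_of_pos hen, abs_norm, ← dist_eq_norm]
  exact not_le.1 fun hle => hω (hn hle)

end Consistency

lemma PointProcess.mixingCoeff_one_one_isBigO {Ω : Type*} [MeasurableSpace Ω] {μ : Measure Ω}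
    [IsProbabilityMeasure μ] {d : ℕ} {X : PointProcess Ω d} {k l : ℕ∞} (hk : 1 ≤ k) (hl : 1 ≤ l)
    {g : ℝ → ℝ} (h : (fun q => X.mixingCoeff μ k l q) =O[atTop] g) :
    (fun q => X.mixingCoeff μ 1 1 q) =O[atTop] g := by
  refine .trans (.of_norm_le fun q => ?_) h
  rw [Real.norm_of_nonneg mixingCoeff_nonneg]
  exact mixingCoeff_mono hk hl

lemma exists_isBoundedDesign {d : ℕ} {z : ℕ → Space d → ℝ} {w : Space d → ℝ} {p : ℕ → ℕ}
    (hz : ∀ j, Measurable (z j)) (hzbdd : ∃ M : ℝ, ∀ n, ∀ i < p n, ∀ u, |z i u| ≤ M)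
    (hw : Measurable w) (hw0 : ∀ u, 0 ≤ w u) (hwbdd : ∃ W : ℝ, ∀ u, w u ≤ W) :
    ∃ M W, ∀ n, IsBoundedDesign z w (p n) M W := by
  obtain ⟨M, hM⟩ := hzbdd
  obtain ⟨W, hW⟩ := hwbdd
  exact ⟨|M|, W, fun n => ⟨fun j _ => hz j, fun j hj u => (hM n j hj u).trans (le_abs_self M),
    abs_nonneg M, hw, hw0, hW⟩⟩

theorem theorem1_general {Ω : Type*} [MeasurableSpace Ω] (μ : Measure Ω) [IsProbabilityMeasure μ]
    {d : ℕ} (X : PointProcess Ω d) {s : ℕ} (b : Fin s → ℝ) (p : ℕ → ℕ)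
    (D : ℕ → Set (Space d)) (hD : ∀ n, Bornology.IsBounded (D n)) (hDm : ∀ n, MeasurableSet (D n))
    (hcover : ∃ C, ∀ᶠ n in atTop, IsCoveredByCells (C * volume.real (D n)) (D n))
    (z : ℕ → Space d → ℝ) (w : Space d → ℝ)
    (hzw : ∃ M W, ∀ n, IsBoundedDesign z w (p n) M W)
    (hρ : ∀ n, X.HasIntensity μ fun u => intensity z u (trueParam b (p n)))
    (Θ : ∀ n, Set (EuclideanSpace ℝ (Fin (p n)))) (t : ℕ) (ht : t ≠ 0)
    (hprod : ∃ ρr, X.HasProductDensity μ (2 + t) ρr ∧ ∃ M : ℝ, ∀ v, ρr v ≤ M)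
    (hmix : ∃ τ : ℝ, (d : ℝ) * (2 + t) / t < τ ∧
      (fun q : ℝ => X.mixingCoeff μ 1 1 q) =O[atTop] fun q : ℝ => q ^ (-τ))
    (hA : (0 : EReal) < liminf (fun n => ((minEigenvalue
      ((volume.real (D n))⁻¹ • sensitivity z w (D n) (trueParam b (p n))) : ℝ) : EReal)) atTop)
    (pen : ℝ → ℝ → ℝ) (lam : ℕ → ℕ → ℝ) (hpen0 : ∀ n j, pen (lam n j) 0 = 0)
    (hpen_nonneg : ∀ n j, ∀ θ, 0 ≤ θ → 0 ≤ pen (lam n j) θ)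
    (hpen : ∀ n j, LowerSemicontinuousOn (pen (lam n j)) (Ici 0))
    (hsmooth : ∃ r : ℕ → Fin s → ℝ,
      (∀ j, Tendsto (fun n => r n j * √(volume.real (D n) / p n)) atTop atTop) ∧
      ∃ M : ℝ, ∀ᶠ n in atTop, ∀ j : Fin s,
        ContDiffOn ℝ 3 (pen (lam n j)) (Metric.ball |b j| (r n j)) ∧
        ∀ θ ∈ Metric.ball |b j| (r n j), |iteratedDeriv 3 (pen (lam n j)) θ| ≤ M)
    (hp : Tendsto (fun n => (p n : ℝ) ^ 2 / volume.real (D n)) atTop (𝓝 0))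
    (ha : aSeq pen lam b =O[atTop] fun n => (√(volume.real (D n)))⁻¹)
    (hc : cSeq pen lam b =o[atTop] fun _ => (1 : ℝ)) :
    ∃ βhat : ∀ n, Ω → EuclideanSpace ℝ (Fin (p n)),
      (∀ n, Measurable (βhat n)) ∧
      Tendsto (fun n => μ {ω | ¬ IsLocalMax
        (fun β : EuclideanSpace ℝ (Fin (p n)) =>
          penLogLik z w pen (lam n) (D n) (X.pts ω) β) (βhat n ω)}) atTop (𝓝 0) ∧
      IsBigOP μ (fun n ω => ‖βhat n ω - trueParam b (p n)‖)
        (fun n => √(p n) * ((√(volume.real (D n)))⁻¹ + aSeq pen lam b n)) ∧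
      IsBigOP μ (fun n ω => ‖βhat n ω - trueParam b (p n)‖)
        (fun n => √(p n / volume.real (D n))) ∧
      ((∀ K : ℝ, ∀ᶠ n in atTop,
          Metric.closedBall (trueParam b (p n)) (K * √(p n / volume.real (D n))) ⊆ Θ n) →
        Tendsto (fun n => μ {ω | βhat n ω ∉ Θ n}) atTop (𝓝 0)) := by
  obtain ⟨C, hcover⟩ := hcover
  obtain ⟨M, W, hzw⟩ := hzw
  obtain ⟨ρr, hρr, M', hM'⟩ := hprod
  obtain ⟨τ, hτ, hmix⟩ := hmix
  obtain ⟨r, hr, L, hsmooth⟩ := hsmooth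
  obtain ⟨ν, hν, hνA⟩ := exists_pos_eventually_lt_of_pos_liminf hA
  have hpv : ∀ᶠ n in atTop, 0 < p n ∧ 0 < volume.real (D n) := hνA.mono fun n hn =>
    pos_of_minEigenvalue_inv_smul_ne_zero measureReal_nonneg (hν.trans hn).ne'
  have hpv' : ∀ᶠ n in atTop, 0 < (p n : ℝ) ∧ 0 < volume.real (D n) := by simpa using hpv
  have he : ∀ᶠ n in atTop, 0 < √(p n / volume.real (D n)) :=
    hpv'.mono fun n hn => Real.sqrt_pos.2 (div_pos hn.1 hn.2)
  obtain ⟨k, hk, hlocal⟩ := exists_tendsto_atTop_eventually_abs_pen_add_sub_le hpv hp hr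
    hsmooth hc (κ := ν / 8) (by positivity) M
  choose βhat hmeas hβhat using fun n =>
    (hzw n).exists_measurable_isMaxOn_penLogLik X (hD n) (hDm n) (hpen n)
      (isCompact_closedBall (trueParam b (p n)) (k n * √(p n / volume.real (D n))))
      ⟨_, Metric.mem_closedBall_self (by positivity)⟩
  have hscore := isBigOP_norm_score hzw hD hDm hcover
    (hpv'.mono fun n hn => mul_pos hn.1 hn.2) hρ ht hρr hM' hτ hmix
  have hrate : IsBigOP μ (fun n ω => ‖βhat n ω - trueParam b (p n)‖)
      fun n => √(p n / volume.real (D n)) := by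
    refine hscore.of_mul_le_add (c := ν / 8) (K := s)
      (hpv.mono fun n hn => by exact_mod_cast hn.1) (hpv.mono fun n hn => hn.2) ha
      (by positivity) s.cast_nonneg ?_
    filter_upwards [hpv, hνA, hlocal] with n hn hνn hlocn ω
    obtain ⟨hball, hmax⟩ := hβhat n ω
    exact ⟨norm_nonneg _, (hzw n).norm_sub_trueParam_le X (hD n) hn.2 (hpen0 n) (hpen_nonneg n)
      (aSeq_nonneg pen lam b n) hν.le hνn.le hlocn.1 hlocn.2 (mem_closedBall_iff_norm.1 hball)
      (hmax (Metric.mem_closedBall_self (by positivity)))⟩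
  refine ⟨βhat, hmeas, hrate.tendsto_measure_not_isLocalMax he hk fun n ω => (hβhat n ω).2,
    hrate.mono (.of_forall fun n => ?_), hrate, fun hΘ => hrate.tendsto_measure_notMem hΘ he⟩
  rw [Real.sqrt_div (p n).cast_nonneg, div_eq_mul_inv]
  refine abs_le_abs_of_nonneg (by positivity) ?_
  gcongr
  exact le_add_of_nonneg_right (aSeq_nonneg pen lam b n)

theorem theorem1 {Ω : Type*} [MeasurableSpace Ω] (μ : Measure Ω) [IsProbabilityMeasure μ]
    {d : ℕ} (hd : 0 < d) (X : PointProcess Ω d)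
    -- number of nonzero coefficients, their values, and the diverging dimension
    {s : ℕ} (b : Fin s → ℝ) (hb : ∀ j, b j ≠ 0) (p : ℕ → ℕ) (hsp : ∀ n, s ≤ p n)
    -- the windows `D_n = nE`
    (E : Set (Space d)) (hEconv : Convex ℝ E) (hEcomp : IsCompact E) (hE0 : 0 ∈ interior E)
    -- covariates and weight function
    (z : ℕ → Space d → ℝ) (hz : ∀ j, Measurable (z j))
    (hzbdd : ∃ M : ℝ, ∀ n, ∀ i < p n, ∀ u, |z i u| ≤ M)
    (w : Space d → ℝ) (hw : Measurable w) (hw0 : ∀ u, 0 ≤ w u) (hwbdd : ∃ M : ℝ, ∀ u, w u ≤ M)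
    -- log-linear intensity with true parameter `β₀` in the parameter sets `Θ_n`
    (hρ : ∀ n, X.HasIntensity μ fun u => intensity z u (trueParam b (p n)))
    (Θ : ∀ n, Set (EuclideanSpace ℝ (Fin (p n))))
    (hΘ : ∀ n, IsOpen (Θ n) ∧ Convex ℝ (Θ n) ∧ Bornology.IsBounded (Θ n) ∧
      trueParam b (p n) ∈ Θ n)
    (hΞ : ∃ Ξ : ∀ n, Set (EuclideanSpace ℝ (Fin (p n))),
      (∀ n, Ξ n ∈ 𝓝 (trueParam b (p n))) ∧
      ∃ M : ℝ, ∀ n, ∀ β ∈ Ξ n, ∀ u : Space d, intensity z u β ≤ M)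
    -- bounded product densities of orders `2, …, 2 + t`
    (t : ℕ) (ht : 1 ≤ t)
    (hprod : ∀ k : ℕ, 2 ≤ k → k ≤ 2 + t → ∃ ρk : (Fin k → Space d) → ℝ,
      X.HasProductDensity μ k ρk ∧ ∃ M : ℝ, ∀ v, ρk v ≤ M)
    -- strong mixing
    (hmix : ∃ τ : ℝ, (d : ℝ) * (2 + t) / t < τ ∧
      (fun q : ℝ => X.mixingCoeff μ 2 ⊤ q) =O[atTop] fun q : ℝ => q ^ (-τ))
    -- `liminf ν_min(|D_n|⁻¹ A_n(w; β₀)) > 0`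
    (hA : (0 : EReal) < liminf (fun n => ((minEigenvalue
      ((windowVol E n)⁻¹ • sensitivity z w (window E n) (trueParam b (p n))) : ℝ) : EReal)) atTop)
    -- penalties and tuning parameters
    (pen : ℝ → ℝ → ℝ) (hpen : IsPenaltyFamily pen)
    (lam : ℕ → ℕ → ℝ) (hlam : ∀ n j, 0 ≤ lam n j)
    (hsmooth : ∃ r : ℕ → Fin s → ℝ,
      (∀ j, Tendsto (fun n => r n j * √(windowVol E n / p n)) atTop atTop) ∧
      ∃ M : ℝ, ∀ᶠ n in atTop, ∀ j : Fin s,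
        ContDiffOn ℝ 3 (pen (lam n j)) (Metric.ball |b j| (r n j)) ∧
        ∀ θ ∈ Metric.ball |b j| (r n j), |iteratedDeriv 3 (pen (lam n j)) θ| ≤ M)
    -- growth of the dimension, and the rates of `a_n` and `c_n`
    (hp : Tendsto (fun n => (p n : ℝ) ^ 3 / windowVol E n) atTop (𝓝 0))
    (ha : aSeq pen lam b =O[atTop] fun n => (√(windowVol E n))⁻¹)
    (hc : cSeq pen lam b =o[atTop] fun _ => (1 : ℝ)) :
    ∃ βhat : ∀ n, Ω → EuclideanSpace ℝ (Fin (p n)),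
      (∀ n, Measurable (βhat n)) ∧
      -- with probability tending to one, `βhat n` is a local maximizer of `Q_n(w; ·)`
      Tendsto (fun n => μ {ω | ¬ IsLocalMax
        (fun β : EuclideanSpace ℝ (Fin (p n)) =>
          penLogLik z w pen (lam n) (window E n) (X.pts ω) β) (βhat n ω)}) atTop (𝓝 0) ∧
      IsBigOP μ (fun n ω => ‖βhat n ω - trueParam b (p n)‖)
        (fun n => √(p n) * ((√(windowVol E n))⁻¹ + aSeq pen lam b n)) ∧
      -- root-`(|D_n| / p_n)` consistency
      IsBigOP μ (fun n ω => ‖βhat n ω - trueParam b (p n)‖) (fun n => √(p n / windowVol E n)) ∧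
      -- the local maximizer lies in `Θ_n` as soon as `Θ_n` does not shrink to `β₀` too fast
      ((∀ K : ℝ, ∀ᶠ n in atTop,
          Metric.closedBall (trueParam b (p n)) (K * √(p n / windowVol E n)) ⊆ Θ n) →
        Tendsto (fun n => μ {ω | βhat n ω ∉ Θ n}) atTop (𝓝 0)) := by
  obtain ⟨τ, hτ, hmix⟩ := hmix
  have hDcomp : ∀ n, IsCompact (window E n) := fun n => hEcomp.smul _
  exact theorem1_general μ X b p (window E) (fun n => (hDcomp n).isBounded)
    (fun n => (hDcomp n).measurableSet) (exists_isCoveredByCells_window hEcomp ⟨0, hE0⟩) z w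
    (exists_isBoundedDesign hz hzbdd hw hw0 hwbdd) hρ Θ t (by lia) (hprod (2 + t) (by lia) le_rfl)
    ⟨τ, hτ, PointProcess.mixingCoeff_one_one_isBigO (by norm_num) le_top hmix⟩ hA pen lam
    (fun n j => hpen.zero _ (hlam n j)) (fun n j => hpen.nonneg _ (hlam n j))
    (fun n j => hpen.lowerSemicontinuousOn (hlam n j)) hsmooth
    (tendsto_sq_div_of_tendsto_cube_div (fun _ => measureReal_nonneg) hp) ha hc
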